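/- Consider a dual-hop amplify-and-forward relaying system with a single-antenna source and destination, an energy-harvesting relay with $N\ge 1$ antennas, and one co-channel interferer at the relay. The channel vectors $\mathbf h_1$ (source–relay, $N\times1$), $\mathbf h_I$ (interferer–relay, $N\times 1$) and $\mathbf h_2$ (relay–destination, $1\times N$) have $3N$ independent $\mathcal{CN}(0,1)$ entries; $d_1,d_I,d_2>0$ are the corresponding distances, $\tau$ is the path loss exponent, $\theta\in(0,1)$ the power splitting ratio, $\eta>0$ the energy conversion efficiency, $N_0>0$ the noise power, $P_s$ and $P_I$ the source and interference powers, $\rho_1=P_s/N_0$ and $\rho_I=P_I/N_0>0$. With a relay transformation matrix $\mathbf W$ the end-to-end SINR is $$\gamma=\frac{\frac{(1-\theta)P_s}{d_1^\tau d_2^\tau}|\mathbf h_2\mathbf W\mathbf h_1|^2}{\frac{(1-\theta)P_I}{d_I^\tau d_2^\tau}|\mathbf h_2\mathbf W\mathbf h_I|^2+\frac{\|\mathbf h_2\mathbf W\|^2}{d_2^\tau}N_0+N_0}.$$ The MRC/MRT scheme uses $\mathbf W=\omega\,\frac{\mathbf h_2^\dagger\mathbf h_1^\dagger}{\|\mathbf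 h_2\|\,\|\mathbf h_1\|}$ with $$\omega^2=\frac{\eta\theta\left(\frac{P_s}{d_1^\tau}\|\mathbf h_1\|^2+\frac{P_I}{d_I^\tau}\|\mathbf h_I\|^2\right)}{\frac{(1-\theta)P_s}{d_1^\tau}\|\mathbf h_1\|^2+\frac{(1-\theta)P_I}{d_I^\tau}\frac{|\mathbf h_1^\dagger\mathbf h_I|^2}{\|\mathbf h_1\|^2}+N_0},$$ so that the relay transmits with its harvested power. Let $P_{\mathrm{out}}(\rho_1)=\Pr(\gamma<\gamma_{\rm th})$ be its outage probability for a fixed threshold $\gamma_{\rm th}>0$. Then, as $\rho_1\to\infty$ with all other parameters (in particular $\rho_I$ and $N_0$) fixed, the ratio of $P_{\mathrm{out}}(\rho_1)$ to $$\left(\frac{d_1^\tau\gamma_{\rm th}}{\rho_1}\right)^{N}\left(\left(\frac1{1-\theta}\right)^{N}\sum_{n=0}^{N}\frac{((1-\theta)\rho_I)^n}{d_I^{n\tau}(N-n)!}+\frac{d_2^{N\tau}\sum_{i=0}^{N-1}\binom{N-1}{i}(-1)^{N-i-1}\frac{{}_2F_1\left(N,2N-i-1;2N-i;1-\frac{d_1^\tau\rho_I}{d_I^\tau\rho_1}\right)}{2N-i-1}}{(\eta\theta)^N\,\Gamma(N+1)\,\Gamma(N)}\right)$$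 tends to $1$. Moreover the full diversity order $N$ is achieved: $\displaystyle\lim_{\rho_1\to\infty}\frac{-\log P_{\mathrm{out}}(\rho_1)}{\log\rho_1}=N$. -/

import Mathlib

open MeasureTheory ProbabilityTheory Filter Topology Asymptotics Matrix

/-- The circularly symmetric complex Gaussian law `CN(0,1)` on `ℂ`: real and imaginary part are
independent, centred, and of variance `1/2`. -/
noncomputable def complexNormal : Measure ℂ :=
  ((gaussianReal 0 (1 / 2)).prod (gaussianReal 0 (1 / 2))).map (fun p : ℝ × ℝ => (⟨p.1, p.2⟩ : ℂ))

/-- The law of a vector of `N` independent `CN(0,1)` entries. -/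
noncomputable def complexNormalVec (N : ℕ) : Measure (Fin N → ℂ) :=
  Measure.pi (fun _ => complexNormal)

/-- `h₁`, `hI`, `h₂` are random vectors in `ℂ^N`, all of whose `3N` entries are
independent and `CN(0,1)` distributed. -/
def IsRayleighFading {Ω : Type*} [MeasurableSpace Ω] (μ : Measure Ω) {N : ℕ}
    (h₁ hI h₂ : Ω → Fin N → ℂ) : Prop :=
  HasLaw (fun ω => (h₁ ω, hI ω, h₂ ω))
    ((complexNormalVec N).prod ((complexNormalVec N).prod (complexNormalVec N))) μ

/-- The fixed parameters of the power-splitting relaying system. -/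
structure RelaySystem where
  /-- power splitting ratio: the fraction of the received power used for energy harvesting -/
  θ : ℝ
  /-- RF-to-DC conversion efficiency -/
  η : ℝ
  /-- path loss exponent -/
  τ : ℝ
  /-- distance between source and relay -/
  d₁ : ℝ
  /-- distance between relay and destination -/
  d₂ : ℝ
  /-- distance between interferer and relay -/
  dI : ℝ
  /-- noise power per antenna, at the relay and at the destination -/
  N₀ : ℝ

/-- The parameters lie in their physical range. -/
structure RelaySystem.Admissible (S : RelaySystem) : Prop where
  θ_pos : 0 < S.θ
  θ_lt_one : S.θ < 1
  η_pos : 0 < S.η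
  d₁_pos : 0 < S.d₁
  d₂_pos : 0 < S.d₂
  dI_pos : 0 < S.dI
  N₀_pos : 0 < S.N₀

/-- The squared Euclidean (Frobenius) norm of a complex vector. -/
noncomputable def normSqVec {N : ℕ} (v : Fin N → ℂ) : ℝ := ∑ i, ‖v i‖ ^ 2

namespace RelaySystem

variable (S : RelaySystem) {N : ℕ}

/-- The relay transmit power: the energy harvested in the first half block from the source
(power `pS`) and the interferer (power `pI`), divided by the length of the second half block. -/
noncomputable def relayPower (pS pI : ℝ) (h₁ hI : Fin N → ℂ) : ℝ :=
  S.η * S.θ * (pS / S.d₁ ^ S.τ * normSqVec h₁ + pI / S.dI ^ S.τ * normSqVec hI)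

/-- The end-to-end signal-to-interference-and-noise ratio at the destination when the relay applies
the transformation matrix `W` to its received signal
`√((1-θ) pS / d₁^τ) h₁ x + √((1-θ) pI / dI^τ) hI s + n`, and the destination receives
`√(1 / d₂^τ) h₂ W y + n'` (with `h₂` a row vector). -/
noncomputable def sinr (pS pI : ℝ) (h₁ hI h₂ : Fin N → ℂ) (W : Matrix (Fin N) (Fin N) ℂ) : ℝ :=
  ((1 - S.θ) * pS / (S.d₁ ^ S.τ * S.d₂ ^ S.τ) * ‖h₂ ⬝ᵥ (W *ᵥ h₁)‖ ^ 2) /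
    ((1 - S.θ) * pI / (S.dI ^ S.τ * S.d₂ ^ S.τ) * ‖h₂ ⬝ᵥ (W *ᵥ hI)‖ ^ 2
      + normSqVec (h₂ ᵥ* W) / S.d₂ ^ S.τ * S.N₀ + S.N₀)

/-- The squared power constraint factor of the MRC/MRT scheme: it makes the mean power of the
relay's transmitted signal equal to `relayPower`. -/
noncomputable def mrcFactorSq (pS pI : ℝ) (h₁ hI : Fin N → ℂ) : ℝ :=
  S.relayPower pS pI h₁ hI /
    ((1 - S.θ) * pS / S.d₁ ^ S.τ * normSqVec h₁
      + (1 - S.θ) * pI / S.dI ^ S.τ * (‖star h₁ ⬝ᵥ hI‖ ^ 2 / normSqVec h₁) + S.N₀)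

/-- The MRC/MRT transformation matrix `ω h₂† h₁† / (‖h₂‖ ‖h₁‖)`: maximum ratio combining of the
received signal followed by maximum ratio transmission. -/
noncomputable def mrcMatrix (pS pI : ℝ) (h₁ hI h₂ : Fin N → ℂ) : Matrix (Fin N) (Fin N) ℂ :=
  ((√(S.mrcFactorSq pS pI h₁ hI) / (√(normSqVec h₂) * √(normSqVec h₁)) : ℝ) : ℂ) •
    vecMulVec (star h₂) (star h₁)

/-- The end-to-end SINR of the MRC/MRT scheme. -/
noncomputable def mrcSinr (pS pI : ℝ) (h₁ hI h₂ : Fin N → ℂ) : ℝ :=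
  S.sinr pS pI h₁ hI h₂ (S.mrcMatrix pS pI h₁ hI h₂)

/-- The outage probability of the MRC/MRT scheme at threshold `γth`, with source and interferer
powers given through the normalized powers `ρ₁ = pS / N₀` and `ρI = pI / N₀`. -/
noncomputable def mrcOutage {Ω : Type*} [MeasurableSpace Ω] (μ : Measure Ω)
    (h₁ hI h₂ : Ω → Fin N → ℂ) (γth ρI ρ₁ : ℝ) : ℝ :=
  μ.real {ω | S.mrcSinr (ρ₁ * S.N₀) (ρI * S.N₀) (h₁ ω) (hI ω) (h₂ ω) < γth}

/-- The high-SNR approximation of the outage probability of the MRC/MRT scheme. -/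
noncomputable def mrcOutageApprox (N : ℕ) (γth ρI ρ₁ : ℝ) : ℝ :=
  (S.d₁ ^ S.τ * γth / ρ₁) ^ N *
    ((1 / (1 - S.θ)) ^ N *
        ∑ n ∈ Finset.range (N + 1),
          ((1 - S.θ) * ρI) ^ n / (S.dI ^ ((n : ℝ) * S.τ) * (Nat.factorial (N - n) : ℝ))
      + S.d₂ ^ ((N : ℝ) * S.τ) *
          (∑ i ∈ Finset.range N,
            (Nat.choose (N - 1) i : ℝ) * (-1) ^ (N - i - 1) *
              (ordinaryHypergeometric (N : ℝ) (2 * (N : ℝ) - i - 1) (2 * (N : ℝ) - i)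
                  (1 - S.d₁ ^ S.τ * ρI / (S.dI ^ S.τ * ρ₁)) /
                (2 * (N : ℝ) - i - 1))) /
          ((S.η * S.θ) ^ N * (Real.Gamma ((N : ℝ) + 1) * Real.Gamma (N : ℝ))))

end RelaySystem

/-! Put a = ρ₁/d₁^τ, b = ρI/dI^τ, κ = γ d₂^τ/(ηθ), and let X, Z, Y be the squared norms of h₁, hI,
h₂, which are independent Gamma variables of shape N. Both the outage probability and its
approximation are shown to be asymptotic to C log a / a^N with C = κ^N/(N!(N-1)!); comparing the two
limits gives the equivalence, and log log a / log a → 0 gives the diversity order.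

Outage probability: up to negligible events, outage means that the product aXY is below κ. Given X =
x, the event Y < κ/(ax) has probability about (κ/(ax))^N/N!; against the density
x^(N-1)e^(-x)/(N-1)! the powers of x cancel down to 1/x, and integrating from about 1/a to about 1
produces log a (`gainLaw_prod_mul_lt_le`, `le_gainLaw_prod_mul_lt`). The interference enters only
through Z: either aX fails to dominate s(1 + (1-θ)bZ), which costs O((s/a)^N)
(`gainLaw_prod_le_affine`), or interference and relay noise change κ by a factor tending to 1 as s
grows. The slowly growing cut-off s is chosen so that s^N = o(log a).

Approximation: the finite sum in it does not depend on ρ₁ and is swallowed by log a. The alternating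
hypergeometric sum is a power series with coefficients 1/(n+1) + O(1/(n+1)²), so at 1 - ε it behaves
like -log ε (`tendsto_hasSum_betaKernelCoeff_div_log`); here ε = b/a. -/

/-! ### Complex Gaussian densities and the volume of balls. -/

/-- A product of copies of a measure with an integrable density has the product density. -/
lemma pi_withDensity_ofReal {ι E : Type*} [Fintype ι] [MeasureSpace E]
    [SigmaFinite (volume : Measure E)] {g : E → ℝ} (hg : Integrable g) (h0 : ∀ x, 0 ≤ g x) :
    Measure.pi (fun _ : ι => (volume : Measure E).withDensity (fun x => ENNReal.ofReal (g x))) =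
      (volume : Measure (ι → E)).withDensity (fun x => ENNReal.ofReal (∏ i, g (x i))) := by
  refine (Measure.pi_eq fun s hs => ?_)
  rw [withDensity_apply _ (MeasurableSet.univ_pi hs), volume_pi, Measure.restrict_pi_pi,
    ← ofReal_integral_eq_lintegral_ofReal, integral_fintype_prod_eq_prod,
    ENNReal.ofReal_prod_of_nonneg]
  · refine Finset.prod_congr rfl fun i _ => ?_
    rw [withDensity_apply _ (hs i), ofReal_integral_eq_lintegral_ofReal hg.restrict
      (ae_of_all _ h0)]
  · exact fun i _ => integral_nonneg h0
  · exact Integrable.fintype_prod fun i => hg.restrict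
  · exact ae_of_all _ fun x => Finset.prod_nonneg fun i _ => h0 _

lemma gaussianPDFReal_zero_half (x : ℝ) :
    gaussianPDFReal 0 (1 / 2) x = (√Real.pi)⁻¹ * Real.exp (-x ^ 2) := by
  have h2 : √(2 : ℝ) ≠ 0 := by positivity
  simp [gaussianPDFReal]
  field_simp

/-- The density of `CN(0,1)`. -/
lemma complexNormal_eq_withDensity :
    complexNormal = (volume : Measure ℂ).withDensity
      (fun z => ENNReal.ofReal (Real.pi⁻¹ * Real.exp (-‖z‖ ^ 2))) := by
  have hv : (1 / 2 : NNReal) ≠ 0 := by norm_num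
  have hm : Measurable (fun z : ℂ => ENNReal.ofReal (Real.pi⁻¹ * Real.exp (-‖z‖ ^ 2))) := by
    fun_prop
  have e : (fun p : ℝ × ℝ => (⟨p.1, p.2⟩ : ℂ)) = Complex.measurableEquivRealProd.symm := rfl
  rw [complexNormal, gaussianReal_of_var_ne_zero _ hv, prod_withDensity
    (measurable_gaussianPDF _ _) (measurable_gaussianPDF _ _), e]
  have hp := Complex.volume_preserving_equiv_real_prod.symm
  ext s hs
  rw [Measure.map_apply (MeasurableEquiv.measurable _) hs,
    withDensity_apply _ (MeasurableEquiv.measurable _ hs), withDensity_apply _ hs,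
    ← hp.setLIntegral_comp_preimage hs hm, ← Measure.volume_eq_prod]
  refine lintegral_congr fun p => ?_
  rw [gaussianPDF, gaussianPDF, ← ENNReal.ofReal_mul (gaussianPDFReal_nonneg _ _ _),
    gaussianPDFReal_zero_half, gaussianPDFReal_zero_half]
  congr 1
  have h1 : ‖Complex.measurableEquivRealProd.symm p‖ ^ 2 = p.1 ^ 2 + p.2 ^ 2 := by
    rw [Complex.sq_norm, Complex.normSq_apply]
    simp [Complex.measurableEquivRealProd_symm_apply, sq]
  rw [h1, neg_add, Real.exp_add, mul_mul_mul_comm, ← mul_inv,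
    Real.mul_self_sqrt Real.pi_pos.le]

instance : IsProbabilityMeasure complexNormal :=
  Measure.isProbabilityMeasure_map (by
    have e : (fun p : ℝ × ℝ => (⟨p.1, p.2⟩ : ℂ)) = Complex.measurableEquivRealProd.symm := rfl
    rw [e]; exact (MeasurableEquiv.measurable _).aemeasurable)

instance (N : ℕ) : IsProbabilityMeasure (complexNormalVec N) := by
  unfold complexNormalVec; infer_instance

/-- The density of a vector of independent `CN(0,1)` entries. -/
lemma complexNormalVec_eq_withDensity (N : ℕ) :
    complexNormalVec N = (volume : Measure (Fin N → ℂ)).withDensity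
      (fun x => ENNReal.ofReal ((Real.pi⁻¹) ^ N * Real.exp (-normSqVec x))) := by
  have hi : Integrable (fun z : ℂ => Real.pi⁻¹ * Real.exp (-‖z‖ ^ 2)) := by
    refine ⟨by fun_prop, ?_⟩
    have h := measure_lt_top complexNormal Set.univ
    rw [complexNormal_eq_withDensity, withDensity_apply _ MeasurableSet.univ,
      Measure.restrict_univ] at h
    rw [hasFiniteIntegral_iff_ofReal (ae_of_all _ fun z => by positivity)]
    exact h
  rw [complexNormalVec, complexNormal_eq_withDensity, pi_withDensity_ofReal hi
    (fun z => by positivity)]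
  congr 1
  ext x
  rw [Finset.prod_mul_distrib, ← Real.exp_sum]
  simp [normSqVec]

lemma measurable_normSqVec {N : ℕ} : Measurable (normSqVec : (Fin N → ℂ) → ℝ) := by
  unfold normSqVec; fun_prop

lemma normSqVec_nonneg {N : ℕ} (v : Fin N → ℂ) : 0 ≤ normSqVec v := by
  unfold normSqVec; positivity

lemma volume_normSqVec_lt {N : ℕ} (hN : 1 ≤ N) {r : ℝ} (hr : 0 ≤ r) :
    volume {x : Fin N → ℂ | normSqVec x < r} =
      ENNReal.ofReal (Real.pi ^ N * r ^ N / N.factorial) := by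
  have : Nonempty (Fin N) := ⟨⟨0, hN⟩⟩
  have h := Complex.volume_sum_rpow_lt (Fin N) (p := 2) one_le_two (√r)
  have e : {x : Fin N → ℂ | (∑ i, ‖x i‖ ^ (2 : ℝ)) ^ (1 / 2 : ℝ) < √r} =
      {x : Fin N → ℂ | normSqVec x < r} := by
    ext x
    simp only [Set.mem_ofPred, normSqVec, Real.rpow_two, ← Real.sqrt_eq_rpow]
    exact Real.sqrt_lt_sqrt_iff (by positivity)
  rw [e] at h
  rw [h, ← ENNReal.ofReal_pow (Real.sqrt_nonneg _), ← ENNReal.ofReal_mul (by positivity)]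
  congr 1
  have h2 : (2 * (Fintype.card (Fin N) : ℝ) / 2 + 1) = (N : ℝ) + 1 := by simp
  rw [h2, Real.Gamma_nat_eq_factorial, pow_mul, Real.sq_sqrt hr]
  have h3 : Real.Gamma (2 / 2 + 1) = 1 := by norm_num [Real.Gamma_two]
  rw [h3]; simp; ring

lemma lintegral_Ioc_pow_div_factorial {N : ℕ} (hN : 1 ≤ N) {t : ℝ} (ht : 0 ≤ t) {c : ℝ}
    (hc : 0 ≤ c) :
    ∫⁻ x in Set.Ioc 0 t, ENNReal.ofReal (c * (x ^ (N - 1) / (N - 1).factorial)) =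
      ENNReal.ofReal (c * (t ^ N / N.factorial)) := by
  obtain ⟨n, rfl⟩ : ∃ n, N = n + 1 := ⟨N - 1, by omega⟩
  simp only [Nat.add_sub_cancel]
  rw [← ofReal_integral_eq_lintegral_ofReal, ← intervalIntegral.integral_of_le ht]
  · congr 1
    simp only [intervalIntegral.integral_const_mul, intervalIntegral.integral_div,
      integral_pow, Nat.factorial_succ]
    push_cast
    have : (n.factorial : ℝ) ≠ 0 := by positivity
    have : (n : ℝ) + 1 ≠ 0 := by positivity
    field_simp
    simp
  · exact (Continuous.integrableOn_Icc (by fun_prop)).mono_set Set.Ioc_subset_Icc_self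
  · refine (ae_restrict_iff' measurableSet_Ioc).2 (ae_of_all _ fun x hx => ?_)
    have := hx.1
    simp only [Pi.zero_apply]
    positivity

/-- The density of the squared norm under Lebesgue measure. -/
lemma map_normSqVec_volume {N : ℕ} (hN : 1 ≤ N) :
    (volume : Measure (Fin N → ℂ)).map normSqVec =
      (volume.restrict (Set.Ioi (0 : ℝ))).withDensity
        (fun x => ENNReal.ofReal (Real.pi ^ N * (x ^ (N - 1) / (N - 1).factorial))) := by
  obtain ⟨n, rfl⟩ : ∃ n, N = n + 1 := ⟨N - 1, by omega⟩
  simp only [Nat.add_sub_cancel]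
  set ν := (volume : Measure (Fin (n + 1) → ℂ)).map normSqVec
  set ν' := (volume.restrict (Set.Ioi (0 : ℝ))).withDensity
        (fun x => ENNReal.ofReal (Real.pi ^ (n + 1) * (x ^ n / n.factorial)))
  have h1 : ∀ r : ℝ, ν (Set.Iio r) =
      ENNReal.ofReal (Real.pi ^ (n + 1) * (max r 0) ^ (n + 1) / (n + 1).factorial) := by
    intro r
    rw [Measure.map_apply measurable_normSqVec measurableSet_Iio]
    rcases le_total 0 r with hr | hr
    · rw [max_eq_left hr, ← volume_normSqVec_lt hN hr]; rfl
    · have : (normSqVec : (Fin (n + 1) → ℂ) → ℝ) ⁻¹' Set.Iio r = ∅ := by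
        ext x
        simpa using hr.trans (normSqVec_nonneg x)
      simp [this, max_eq_right hr]
  have h2 : ∀ r : ℝ, ν' (Set.Iio r) =
      ENNReal.ofReal (Real.pi ^ (n + 1) * (max r 0) ^ (n + 1) / (n + 1).factorial) := by
    intro r
    rw [withDensity_apply _ measurableSet_Iio, Measure.restrict_restrict measurableSet_Iio]
    rcases le_total 0 r with hr | hr
    · rw [max_eq_left hr, Set.Iio_inter_Ioi, setLIntegral_congr Ioo_ae_eq_Ioc, mul_div_assoc,
        ← lintegral_Ioc_pow_div_factorial hN hr (by positivity)]
      rfl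
    · rw [max_eq_right hr, Set.Iio_inter_Ioi, Set.Ioo_eq_empty (not_lt.2 hr)]
      simp
  -- Both measures have infinite mass, so they are compared on bounded intervals, written as
  -- differences of rays `Iio` of finite measure.
  refine Measure.ext_of_Ico' _ _ (fun a b _ => ?_) fun a b hab => ?_
  · refine ((measure_mono Set.Ico_subset_Iio_self).trans_lt ?_).ne
    rw [h1]; exact ENNReal.ofReal_lt_top
  · have e : Set.Ico a b = Set.Iio b \ Set.Iio a := by ext x; simp
    rw [e, measure_sdiff (Set.Iio_subset_Iio hab.le)
      measurableSet_Iio.nullMeasurableSet, measure_sdiff (Set.Iio_subset_Iio hab.le)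
      measurableSet_Iio.nullMeasurableSet, h1, h1, h2, h2]
    · rw [h2]; exact ENNReal.ofReal_ne_top
    · rw [h1]; exact ENNReal.ofReal_ne_top

/-- The Gaussian density depends on the vector only through its squared norm, so the law of the gain
follows from the image of Lebesgue measure under the norm. -/
lemma map_withDensity_comp {α β : Type*} [MeasurableSpace α] [MeasurableSpace β] (μ : Measure α)
    {T : α → β} (hT : Measurable T) {f : β → ENNReal} (hf : Measurable f) :
    (μ.withDensity (fun x => f (T x))).map T = (μ.map T).withDensity f := by
  ext s hs
  rw [Measure.map_apply hT hs, withDensity_apply _ (hT hs), withDensity_apply _ hs,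
    setLIntegral_map hs hf hT]

/-! ### The Gamma law of a channel gain and its behaviour near zero. -/

/-- The law of the channel gain `‖h‖²`: a Gamma distribution with integer shape `N`. -/
noncomputable def gainLaw (N : ℕ) : Measure ℝ := (complexNormalVec N).map normSqVec

instance (N : ℕ) : IsProbabilityMeasure (gainLaw N) :=
  Measure.isProbabilityMeasure_map measurable_normSqVec.aemeasurable

lemma gainLaw_eq_withDensity {N : ℕ} (hN : 1 ≤ N) :
    gainLaw N = (volume.restrict (Set.Ioi (0 : ℝ))).withDensity
        (fun x => ENNReal.ofReal (x ^ (N - 1) * Real.exp (-x) / (N - 1).factorial)) := by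
  rw [gainLaw, complexNormalVec_eq_withDensity,
    map_withDensity_comp _ measurable_normSqVec
      (f := fun t => ENNReal.ofReal (Real.pi⁻¹ ^ N * Real.exp (-t))) (by fun_prop),
    map_normSqVec_volume hN, ← withDensity_mul _ (by fun_prop) (by fun_prop)]
  refine withDensity_congr_ae ((ae_restrict_iff' measurableSet_Ioi).2 (ae_of_all _ fun x hx => ?_))
  have : 0 < x := hx
  rw [Pi.mul_apply, ← ENNReal.ofReal_mul (by positivity)]
  congr 1
  have h1 : Real.pi ^ N * Real.pi⁻¹ ^ N = 1 := by
    rw [← mul_pow, mul_inv_cancel₀ Real.pi_ne_zero, one_pow]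
  linear_combination (x ^ (N - 1) / (N - 1).factorial * Real.exp (-x)) * h1

lemma gainLaw_apply {N : ℕ} (hN : 1 ≤ N) {s : Set ℝ} (hs : MeasurableSet s) :
    gainLaw N s = ∫⁻ x in s ∩ Set.Ioi 0,
      ENNReal.ofReal (x ^ (N - 1) * Real.exp (-x) / (N - 1).factorial) := by
  rw [gainLaw_eq_withDensity hN, withDensity_apply _ hs, Measure.restrict_restrict hs]

lemma lintegral_gainLaw {N : ℕ} (hN : 1 ≤ N) {f : ℝ → ENNReal} (hf : Measurable f) :
    ∫⁻ x, f x ∂(gainLaw N) = ∫⁻ x in Set.Ioi 0,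
      ENNReal.ofReal (x ^ (N - 1) * Real.exp (-x) / (N - 1).factorial) * f x := by
  rw [gainLaw_eq_withDensity hN, lintegral_withDensity_eq_lintegral_mul _ (by fun_prop) hf]
  rfl

lemma ae_gainLaw_pos {N : ℕ} (hN : 1 ≤ N) : ∀ᵐ x ∂(gainLaw N), 0 < x := by
  rw [gainLaw_eq_withDensity hN]
  exact (withDensity_absolutelyContinuous _ _).ae_le (ae_restrict_mem measurableSet_Ioi)

/-- Here the exponential in the density is bounded by 1; the matching lower bound below uses that it
is at least `exp (-t)` on (0, t). -/
lemma gainLaw_Iic_le {N : ℕ} (hN : 1 ≤ N) {t : ℝ} (ht : 0 ≤ t) :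
    gainLaw N (Set.Iic t) ≤ ENNReal.ofReal (t ^ N / N.factorial) := by
  rw [gainLaw_apply hN measurableSet_Iic, Set.inter_comm, Set.Ioi_inter_Iic,
    ← one_mul (t ^ N / _), ← lintegral_Ioc_pow_div_factorial hN ht zero_le_one]
  refine setLIntegral_mono' measurableSet_Ioc fun x hx => ENNReal.ofReal_le_ofReal ?_
  have := hx.1
  rw [one_mul]
  gcongr
  exact mul_le_of_le_one_right (by positivity) (Real.exp_le_one_iff.2 (by linarith))

lemma le_gainLaw_Iio {N : ℕ} (hN : 1 ≤ N) {t : ℝ} (ht : 0 ≤ t) :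
    ENNReal.ofReal (Real.exp (-t) * (t ^ N / N.factorial)) ≤ gainLaw N (Set.Iio t) := by
  rw [gainLaw_apply hN measurableSet_Iio, Set.Iio_inter_Ioi,
    ← lintegral_Ioc_pow_div_factorial hN ht (Real.exp_pos _).le,
    setLIntegral_congr Ioo_ae_eq_Ioc.symm]
  refine setLIntegral_mono' measurableSet_Ioo fun x hx => ENNReal.ofReal_le_ofReal ?_
  have := hx.1
  have : Real.exp (-t) ≤ Real.exp (-x) := Real.exp_le_exp.2 (by linarith [hx.2])
  rw [← mul_div_assoc, mul_comm (Real.exp _)]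
  gcongr

/-! ### Small values of a product of two gains: the source of the logarithm. -/

lemma lintegral_Ioc_const_div {u v B : ℝ} (hu : 0 < u) (huv : u ≤ v) (hB : 0 ≤ B) :
    ∫⁻ x in Set.Ioc u v, ENNReal.ofReal (B / x) = ENNReal.ofReal (B * Real.log (v / u)) := by
  have h0 : (0 : ℝ) ∉ Set.uIcc u v := by
    rw [Set.uIcc_of_le huv]; exact fun h => absurd h.1 (not_le.2 hu)
  rw [← ofReal_integral_eq_lintegral_ofReal, ← intervalIntegral.integral_of_le huv]
  · congr 1
    simp only [div_eq_mul_inv B, intervalIntegral.integral_const_mul]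
    rw [integral_inv h0]
  · refine (ContinuousOn.integrableOn_Icc ?_).mono_set Set.Ioc_subset_Icc_self
    exact continuousOn_const.div continuousOn_id fun x hx => (hu.trans_le hx.1).ne'
  · refine (ae_restrict_iff' measurableSet_Ioc).2 (ae_of_all _ fun x hx => ?_)
    exact div_nonneg hB (hu.trans hx.1).le

/-- Integrating the section bound against the density of the first gain leaves B e^(-x)/x. On (1/a,
1] this is at most B/x, contributing B log a; beyond 1 it is at most B e^(-x), contributing at most
B. The condition `1 < a * p.1` cuts off the divergence at 0. -/
lemma gainLaw_prod_mul_lt_le {N : ℕ} (hN : 1 ≤ N) {a κ : ℝ} (ha : 1 ≤ a) (hκ : 0 ≤ κ) :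
    ((gainLaw N).prod (gainLaw N)) {p | 1 < a * p.1 ∧ a * p.1 * p.2 < κ} ≤
      ENNReal.ofReal ((κ / a) ^ N / (N.factorial * (N - 1).factorial) * (Real.log a + 1)) := by
  have ha0 : 0 < a := by linarith
  have hai : 1 / a ≤ 1 := by rw [div_le_one ha0]; exact ha
  set B : ℝ := (κ / a) ^ N / (N.factorial * (N - 1).factorial)
  have hB : 0 ≤ B := by positivity
  have hms : MeasurableSet {p : ℝ × ℝ | 1 < a * p.1 ∧ a * p.1 * p.2 < κ} :=
    have h1 : MeasurableSet {p : ℝ × ℝ | 1 < a * p.1} :=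
      measurableSet_lt (by fun_prop) (by fun_prop)
    have h2 : MeasurableSet {p : ℝ × ℝ | a * p.1 * p.2 < κ} :=
      measurableSet_lt (by fun_prop) (by fun_prop)
    h1.inter h2
  rw [Measure.prod_apply hms, lintegral_gainLaw hN (measurable_measure_prodMk_left hms)]
  have hpt : ∀ x ∈ Set.Ioi (0 : ℝ),
      ENNReal.ofReal (x ^ (N - 1) * Real.exp (-x) / (N - 1).factorial) *
        gainLaw N (Prod.mk x ⁻¹' {p | 1 < a * p.1 ∧ a * p.1 * p.2 < κ}) ≤
      (Set.Ioc (1 / a) 1).indicator (fun x => ENNReal.ofReal (B / x)) x +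
        (Set.Ioi 1).indicator (fun x => ENNReal.ofReal (B * Real.exp (-x))) x := by
    intro x hx
    have hx0 : 0 < x := hx
    by_cases h1 : 1 < a * x
    · have hle : ENNReal.ofReal (x ^ (N - 1) * Real.exp (-x) / (N - 1).factorial) *
        gainLaw N (Prod.mk x ⁻¹' {p | 1 < a * p.1 ∧ a * p.1 * p.2 < κ}) ≤
          ENNReal.ofReal (B * (Real.exp (-x) / x)) := by
        have hsub : Prod.mk x ⁻¹' {p | 1 < a * p.1 ∧ a * p.1 * p.2 < κ} ⊆
            Set.Iic (κ / (a * x)) := by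
          rintro y ⟨-, hy⟩
          have hy' : a * x * y < κ := hy
          rw [Set.mem_Iic, le_div_iff₀ (by positivity)]
          linarith
        refine (mul_le_mul_right ((measure_mono hsub).trans
          (gainLaw_Iic_le hN (by positivity))) _).trans_eq ?_
        rw [← ENNReal.ofReal_mul (by positivity)]
        congr 1
        have hxN : x ^ N = x ^ (N - 1) * x := by
          rw [← pow_succ]; congr 1; omega
        simp only [B, div_pow, mul_pow, hxN]
        field_simp
      refine hle.trans ?_
      have hx1 : 1 / a < x := by rw [div_lt_iff₀ ha0]; linarith
      rcases le_or_gt x 1 with h | h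
      · rw [Set.indicator_of_mem (show x ∈ Set.Ioc (1 / a) 1 from ⟨hx1, h⟩)]
        refine le_add_right (ENNReal.ofReal_le_ofReal ?_)
        rw [div_eq_mul_one_div B]
        gcongr
        exact Real.exp_le_one_iff.2 (by linarith)
      · rw [Set.indicator_of_mem (show x ∈ Set.Ioi 1 from h)]
        refine le_add_left (ENNReal.ofReal_le_ofReal ?_)
        gcongr
        exact div_le_self (Real.exp_pos _).le h.le
    · have : Prod.mk x ⁻¹' {p : ℝ × ℝ | 1 < a * p.1 ∧ a * p.1 * p.2 < κ} = ∅ := by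
        ext y; simp [h1]
      simp [this]
  refine (setLIntegral_mono' measurableSet_Ioi hpt).trans ?_
  refine (lintegral_mono' Measure.restrict_le_self le_rfl).trans ?_
  rw [lintegral_add_left (by measurability), lintegral_indicator measurableSet_Ioc,
    lintegral_indicator measurableSet_Ioi, lintegral_Ioc_const_div (by positivity) hai hB,
    mul_add, ENNReal.ofReal_add (by have := Real.log_nonneg ha; positivity) (by positivity)]
  gcongr
  · simp
  · rw [← ofReal_integral_eq_lintegral_ofReal, integral_const_mul, integral_exp_neg_Ioi]
    · gcongr
      exact Real.exp_le_one_iff.2 (by norm_num)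
    · exact (integrableOn_exp_neg_Ioi 1).const_mul B
    · exact ae_of_all _ fun x => by simp only [Pi.zero_apply]; positivity

/-- Only x in (s/a, 1/s] is kept. There ax > s, so adding m costs at most a factor 1 + m/s, and both
exponentials are close to 1 for large s; the integral of 1/x is still log(a/s²). -/
lemma le_gainLaw_prod_mul_lt {N : ℕ} (hN : 1 ≤ N) {a κ m s : ℝ} (hκ : 0 ≤ κ) (hm : 0 ≤ m)
    (hs : 1 ≤ s) (hsa : s ^ 2 ≤ a) :
    ENNReal.ofReal (Real.exp (-(κ / s)) * Real.exp (-(1 / s)) * ((κ / (1 + m / s)) / a) ^ N /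
        (N.factorial * (N - 1).factorial) * Real.log (a / s ^ 2)) ≤
      ((gainLaw N).prod (gainLaw N)) {p | p.2 * (a * p.1 + m) < κ} := by
  have hs0 : 0 < s := by linarith
  have ha0 : 0 < a := by nlinarith
  have hsa' : s / a ≤ 1 / s := by rw [div_le_div_iff₀ ha0 hs0]; linarith [sq s]
  set B : ℝ := Real.exp (-(κ / s)) * Real.exp (-(1 / s)) * ((κ / (1 + m / s)) / a) ^ N /
        (N.factorial * (N - 1).factorial)
  have hB : 0 ≤ B := by positivity
  have hms : MeasurableSet {p : ℝ × ℝ | p.2 * (a * p.1 + m) < κ} :=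
    measurableSet_lt (by fun_prop) (by fun_prop)
  have hlog : a / s ^ 2 = (1 / s) / (s / a) := by field_simp
  rw [Measure.prod_apply hms, lintegral_gainLaw hN (measurable_measure_prodMk_left hms), hlog,
    ← lintegral_Ioc_const_div (by positivity) hsa' hB]
  have hsub : Set.Ioc (s / a) (1 / s) ⊆ Set.Ioi 0 :=
    fun x hx => (show (0 : ℝ) < s / a by positivity).trans hx.1
  refine le_trans ?_ (lintegral_mono_set hsub)
  refine setLIntegral_mono' measurableSet_Ioc fun x hx => ?_
  have hx0 : 0 < x := hsub hx
  have hsx : s < a * x := by have := (div_lt_iff₀ ha0).1 hx.1; linarith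
  set t : ℝ := κ / (1 + m / s) / (a * x)
  have ht0 : 0 ≤ t := by positivity
  have ht : t ≤ κ / s := by
    have : κ / (1 + m / s) ≤ κ := div_le_self hκ (by simp; positivity)
    simp only [t]
    gcongr
  have hsec : Set.Iio t ⊆ Prod.mk x ⁻¹' {p : ℝ × ℝ | p.2 * (a * p.1 + m) < κ} := by
    intro y hy
    have hy' : y < t := hy
    show y * (a * x + m) < κ
    have h1 : a * x + m ≤ (1 + m / s) * (a * x) := by
      have : m / s * s ≤ m / s * (a * x) := by gcongr
      rw [div_mul_cancel₀ _ hs0.ne'] at this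
      linarith
    rcases le_or_gt y 0 with h | h
    -- For κ = 0 the bound t is 0, so y is strictly negative and the product is too.
    · rcases hκ.eq_or_lt with h0 | h0
      · have ht0 : t = 0 := by simp [t, ← h0]
        have := mul_pos_of_neg_of_neg (ht0 ▸ hy') (neg_neg_of_pos (show 0 < a * x + m by positivity))
        linarith
      · exact (mul_nonpos_of_nonpos_of_nonneg h (by positivity)).trans_lt h0
    · have h2 : y * ((1 + m / s) * (a * x)) < κ := by
        rw [← lt_div_iff₀ (by positivity), ← div_div]; exact hy'
      exact (mul_le_mul_of_nonneg_left h1 h.le).trans_lt h2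
  refine le_trans ?_ (mul_le_mul_right ((le_gainLaw_Iio hN ht0).trans (measure_mono hsec)) _)
  rw [← ENNReal.ofReal_mul (by positivity)]
  refine ENNReal.ofReal_le_ofReal ?_
  have hxN : x ^ N = x ^ (N - 1) * x := by
    rw [← pow_succ]; congr 1; omega
  have e1 : Real.exp (-(κ / s)) ≤ Real.exp (-t) := Real.exp_le_exp.2 (by linarith)
  have e2 : Real.exp (-(1 / s)) ≤ Real.exp (-x) := Real.exp_le_exp.2 (by linarith [hx.2])
  calc B / x = Real.exp (-(κ / s)) * Real.exp (-(1 / s)) *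
        (((κ / (1 + m / s)) / a) ^ N / (N.factorial * (N - 1).factorial) / x) := by
        simp only [B]; ring
    _ ≤ Real.exp (-t) * Real.exp (-x) *
        (((κ / (1 + m / s)) / a) ^ N / (N.factorial * (N - 1).factorial) / x) := by gcongr
    _ = _ := by
      simp only [t, ← div_div, div_pow _ x, hxN]
      field_simp

/-- All moments of the channel gain are finite. -/
lemma lintegral_gainLaw_affine_pow_lt_top {N : ℕ} (hN : 1 ≤ N) (β : ℝ) :
    ∫⁻ z, ENNReal.ofReal ((1 + β * z) ^ N) ∂(gainLaw N) < ⊤ := by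
  rw [lintegral_gainLaw hN (by fun_prop)]
  have hi : IntegrableOn
      (fun x : ℝ => x ^ (N - 1) * Real.exp (-x) / (N - 1).factorial * (1 + β * x) ^ N)
      (Set.Ioi 0) := by
    -- Each of the two polynomial factors is absorbed by exp(x/4), leaving exp(-x/2).
    refine integrable_of_isBigO_exp_neg (b := 1 / 2) (by norm_num) (by fun_prop) ?_
    have h1 : (fun x : ℝ => x ^ (N - 1)) =O[atTop] fun x : ℝ => Real.exp (1 / 4 * x) :=
      (isLittleO_pow_exp_pos_mul_atTop (N - 1) (by norm_num)).isBigO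
    have h2 : (fun x : ℝ => 1 + β * x) =O[atTop] fun x : ℝ => x := by
      refine IsBigO.add ?_ ((isBigO_refl _ _).const_mul_left β)
      exact (isLittleO_const_id_atTop (1 : ℝ)).isBigO
    have h3 : (fun x : ℝ => (1 + β * x) ^ N) =O[atTop] fun x : ℝ => Real.exp (1 / 4 * x) :=
      (h2.pow N).trans (isLittleO_pow_exp_pos_mul_atTop N (by norm_num)).isBigO
    have h4 := ((h1.mul h3).mul (isBigO_refl (fun x : ℝ => Real.exp (-x)) atTop)).const_mul_left
      (((N - 1).factorial : ℝ)⁻¹)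
    refine (h4.congr (fun x => by ring) fun x => ?_)
    rw [← Real.exp_add, ← Real.exp_add]
    ring_nf
  refine lt_of_le_of_lt (setLIntegral_mono' measurableSet_Ioi fun x hx => ?_) hi.lintegral_lt_top
  have hx0 : (0 : ℝ) < x := hx
  rw [← ENNReal.ofReal_mul (by positivity)]

/-- Conditioning on the second gain reduces this to `gainLaw_Iic_le`, whose bound is polynomial in
that gain and hence integrable. -/
lemma gainLaw_prod_le_affine {N : ℕ} (hN : 1 ≤ N) {a β s : ℝ} (ha : 0 < a) (hβ : 0 ≤ β)
    (hs : 0 ≤ s) :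
    ((gainLaw N).prod (gainLaw N)) {p | a * p.1 ≤ s * (1 + β * p.2)} ≤
      ENNReal.ofReal ((s / a) ^ N / N.factorial) *
        ∫⁻ z, ENNReal.ofReal ((1 + β * z) ^ N) ∂(gainLaw N) := by
  have hms : MeasurableSet {p : ℝ × ℝ | a * p.1 ≤ s * (1 + β * p.2)} :=
    measurableSet_le (by fun_prop) (by fun_prop)
  rw [Measure.prod_apply_symm hms, ← lintegral_const_mul _ (by fun_prop)]
  refine lintegral_mono_ae ?_
  filter_upwards [ae_gainLaw_pos hN] with z hz
  have e : (fun x => (x, z)) ⁻¹' {p : ℝ × ℝ | a * p.1 ≤ s * (1 + β * p.2)} =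
      Set.Iic (s / a * (1 + β * z)) := by
    ext x
    simp only [Set.preimage_ofPred_eq, Set.mem_ofPred, Set.mem_Iic]
    rw [div_mul_eq_mul_div, le_div_iff₀ ha, mul_comm x]
  rw [e, ← ENNReal.ofReal_mul (by positivity)]
  refine (gainLaw_Iic_le hN (by positivity)).trans_eq ?_
  congr 1
  rw [mul_pow]; ring

/-! ### Transfer of events to the laws of the gains. -/

/-- The joint law of the three channel gains `(‖h₁‖², (‖hI‖², ‖h₂‖²))`. -/
lemma IsRayleighFading.hasLaw_gains {Ω : Type*} [MeasurableSpace Ω] {μ : Measure Ω} {N : ℕ}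
    {h₁ hI h₂ : Ω → Fin N → ℂ} (h : IsRayleighFading μ h₁ hI h₂) :
    HasLaw (fun ω => (normSqVec (h₁ ω), normSqVec (hI ω), normSqVec (h₂ ω)))
      ((gainLaw N).prod ((gainLaw N).prod (gainLaw N))) μ := by
  have hT : MeasurePreserving (normSqVec : (Fin N → ℂ) → ℝ) (complexNormalVec N) (gainLaw N) :=
    ⟨measurable_normSqVec, rfl⟩
  have i1 : SFinite ((complexNormalVec N).prod (complexNormalVec N)) :=
    Measure.prod.instSFinite
  exact (hT.prod (hT.prod hT)).fun_comp_hasLaw h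

/-- Independence of the middle gain from the other two; with `A` the whole line it also gives the
joint law of the outer pair. -/
lemma gains_hasLaw_prod_and {Ω : Type*} [MeasurableSpace Ω] {μ : Measure Ω} {ν : Measure ℝ}
    [IsProbabilityMeasure ν] {X Z Y : Ω → ℝ}
    (h : HasLaw (fun ω => (X ω, Z ω, Y ω)) (ν.prod (ν.prod ν)) μ) {A : Set ℝ}
    (hA : MeasurableSet A) {B : Set (ℝ × ℝ)} (hB : MeasurableSet B) :
    μ {ω | Z ω ∈ A ∧ (X ω, Y ω) ∈ B} = ν A * (ν.prod ν) B := by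
  have hms : MeasurableSet {p : ℝ × ℝ × ℝ | p.2.1 ∈ A ∧ (p.1, p.2.2) ∈ B} :=
    ((measurable_fst.comp measurable_snd) hA).inter
      ((measurable_fst.prodMk (measurable_snd.comp measurable_snd)) hB)
  rw [show {ω | Z ω ∈ A ∧ (X ω, Y ω) ∈ B} = {ω | (fun p : ℝ × ℝ × ℝ => p.2.1 ∈ A ∧
    (p.1, p.2.2) ∈ B) (X ω, Z ω, Y ω)} from rfl, h.measure_eq hms, Measure.prod_apply hms,
    Measure.prod_apply hB, ← lintegral_const_mul _ (measurable_measure_prodMk_left hB)]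
  refine lintegral_congr fun x => ?_
  rw [← Measure.prod_prod]
  rfl

lemma gains_hasLaw_fst_snd {Ω : Type*} [MeasurableSpace Ω] {μ : Measure Ω} {ν : Measure ℝ}
    [IsProbabilityMeasure ν] {X Z Y : Ω → ℝ}
    (h : HasLaw (fun ω => (X ω, Z ω, Y ω)) (ν.prod (ν.prod ν)) μ) {B : Set (ℝ × ℝ)}
    (hB : MeasurableSet B) :
    μ {ω | (X ω, Z ω) ∈ B} = (ν.prod ν) B := by
  have hms : MeasurableSet {p : ℝ × ℝ × ℝ | (p.1, p.2.1) ∈ B} :=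
    (measurable_fst.prodMk (measurable_fst.comp measurable_snd)) hB
  rw [show {ω | (X ω, Z ω) ∈ B} = {ω | (fun p : ℝ × ℝ × ℝ => (p.1, p.2.1) ∈ B) (X ω, Z ω, Y ω)}
    from rfl, h.measure_eq hms, Measure.prod_apply hms, Measure.prod_apply hB]
  refine lintegral_congr fun x => ?_
  have : Prod.mk x ⁻¹' {p : ℝ × ℝ × ℝ | (p.1, p.2.1) ∈ B} = (Prod.mk x ⁻¹' B) ×ˢ Set.univ := by
    ext q; simp
  rw [this, Measure.prod_prod, measure_univ, mul_one]

/-! ### Algebra of the SINR and deterministic outage criteria. -/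

/-- Cauchy–Schwarz bounds the combined interference by the gain of hI, so the law of the inner
product is never needed. -/
lemma norm_dotProduct_star_sq_le {N : ℕ} (u v : Fin N → ℂ) :
    ‖star u ⬝ᵥ v‖ ^ 2 ≤ normSqVec u * normSqVec v := by
  have h : ‖star u ⬝ᵥ v‖ ≤ ∑ i, ‖u i‖ * ‖v i‖ := by
    refine (norm_sum_le _ _).trans_eq (Finset.sum_congr rfl fun i _ => ?_)
    simp
  exact (pow_le_pow_left₀ (norm_nonneg _) h 2).trans (Finset.sum_mul_sq_le_sq_mul_sq _ _ _)

lemma dotProduct_star_self_eq {N : ℕ} (v : Fin N → ℂ) : v ⬝ᵥ star v = (normSqVec v : ℂ) := by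
  simp only [dotProduct, normSqVec, Pi.star_apply, Complex.ofReal_sum]
  refine Finset.sum_congr rfl fun i _ => ?_
  rw [Complex.star_def, Complex.mul_conj, Complex.normSq_eq_norm_sq]

lemma normSqVec_smul {N : ℕ} (c : ℂ) (v : Fin N → ℂ) :
    normSqVec (c • v) = ‖c‖ ^ 2 * normSqVec v := by
  simp [normSqVec, Finset.mul_sum, mul_pow]

lemma normSqVec_star {N : ℕ} (v : Fin N → ℂ) : normSqVec (star v) = normSqVec v := by
  simp [normSqVec]

namespace RelaySystem

variable (S : RelaySystem) {N : ℕ}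

/-- The SINR of a rank one relay matrix `c h₂† h₁†`. -/
lemma sinr_smul_vecMulVec (pS pI c : ℝ) (h₁ hI h₂ : Fin N → ℂ) :
    S.sinr pS pI h₁ hI h₂ ((c : ℂ) • vecMulVec (star h₂) (star h₁)) =
    ((1 - S.θ) * pS / (S.d₁ ^ S.τ * S.d₂ ^ S.τ) *
        (c ^ 2 * normSqVec h₂ ^ 2 * normSqVec h₁ ^ 2)) /
    ((1 - S.θ) * pI / (S.dI ^ S.τ * S.d₂ ^ S.τ) *
        (c ^ 2 * normSqVec h₂ ^ 2 * ‖star h₁ ⬝ᵥ hI‖ ^ 2)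
      + c ^ 2 * normSqVec h₂ ^ 2 * normSqVec h₁ / S.d₂ ^ S.τ * S.N₀ + S.N₀) := by
  have e (v : Fin N → ℂ) : ‖h₂ ⬝ᵥ (((c : ℂ) • vecMulVec (star h₂) (star h₁)) *ᵥ v)‖ ^ 2 =
      c ^ 2 * normSqVec h₂ ^ 2 * ‖star h₁ ⬝ᵥ v‖ ^ 2 := by
    rw [smul_mulVec, vecMulVec_mulVec, dotProduct_smul]
    simp [dotProduct_smul, dotProduct_star_self_eq, mul_pow]
    ring
  have e3 : normSqVec (h₂ ᵥ* ((c : ℂ) • vecMulVec (star h₂) (star h₁))) =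
      c ^ 2 * normSqVec h₂ ^ 2 * normSqVec h₁ := by
    rw [vecMul_smul, vecMul_vecMulVec, dotProduct_star_self_eq, normSqVec_smul, normSqVec_smul,
      normSqVec_star, Complex.norm_real, Complex.norm_real, Real.norm_eq_abs, Real.norm_eq_abs,
      sq_abs, sq_abs, mul_assoc]
  have e4 : ‖star h₁ ⬝ᵥ h₁‖ ^ 2 = normSqVec h₁ ^ 2 := by
    rw [dotProduct_comm, dotProduct_star_self_eq]; simp
  rw [sinr, e, e, e3, e4]

/-- The MRC/MRT outage event in terms of the channel gains, where `a` and `b` are the received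
signal-to-noise ratio and interference-to-noise ratio per unit of channel gain. -/
lemma mrcSinr_lt_iff (hS : S.Admissible) {a b γ : ℝ} (ha : 0 < a) (hb : 0 < b)
    {h₁ hI h₂ : Fin N → ℂ} (h1 : 0 < normSqVec h₁) (h2 : 0 < normSqVec h₂) :
    S.mrcSinr (a * S.d₁ ^ S.τ * S.N₀) (b * S.dI ^ S.τ * S.N₀) h₁ hI h₂ < γ ↔
      (1 - S.θ) * (a * normSqVec h₁) <
        γ * ((1 - S.θ) * b * (‖star h₁ ⬝ᵥ hI‖ ^ 2 / normSqVec h₁) + 1 +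
          S.d₂ ^ S.τ * ((1 - S.θ) * (a * normSqVec h₁) +
            (1 - S.θ) * b * (‖star h₁ ⬝ᵥ hI‖ ^ 2 / normSqVec h₁) + 1) /
          (S.η * S.θ * (normSqVec h₂ * (a * normSqVec h₁ + b * normSqVec hI)))) := by
  obtain ⟨hθ, hθ1, hη, hd₁, hd₂, hdI, hN₀⟩ := hS
  have hq : 0 < 1 - S.θ := by linarith
  have hZ := normSqVec_nonneg hI
  have hV : 0 ≤ ‖star h₁ ⬝ᵥ hI‖ ^ 2 := by positivity
  have hD₁ : 0 < S.d₁ ^ S.τ := Real.rpow_pos_of_pos hd₁ _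
  have hD₂ : 0 < S.d₂ ^ S.τ := Real.rpow_pos_of_pos hd₂ _
  have hDI : 0 < S.dI ^ S.τ := Real.rpow_pos_of_pos hdI _
  rw [mrcSinr, mrcMatrix, sinr_smul_vecMulVec, div_pow, mul_pow, Real.sq_sqrt h1.le,
    Real.sq_sqrt h2.le, Real.sq_sqrt, mrcFactorSq, relayPower]
  · generalize normSqVec h₁ = x at *
    generalize normSqVec h₂ = y at *
    generalize normSqVec hI = z at *
    generalize ‖star h₁ ⬝ᵥ hI‖ ^ 2 = v at *
    generalize S.d₁ ^ S.τ = D₁ at *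
    generalize S.d₂ ^ S.τ = D₂ at *
    generalize S.dI ^ S.τ = DI at *
    generalize S.N₀ = n at *
    generalize 1 - S.θ = q at *
    have hE : 0 < a * x + b * z := by positivity
    have hF : 0 < q * (a * x) + q * b * (v / x) + 1 := by positivity
    have hw1 : S.η * S.θ * (a * D₁ * n / D₁ * x + b * DI * n / DI * z) /
        (q * (a * D₁ * n) / D₁ * x + q * (b * DI * n) / DI * (v / x) + n) =
        S.η * S.θ * (a * x + b * z) / (q * (a * x) + q * b * (v / x) + 1) := by
      rw [div_eq_div_iff (by positivity) hF.ne']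
      field_simp
    rw [hw1]
    have hden : 0 < q * b * (v / x) + 1 + D₂ * (q * (a * x) + q * b * (v / x) + 1) /
          (S.η * S.θ * (y * (a * x + b * z))) := by positivity
    have hw : 0 < S.η * S.θ * (a * x + b * z) := by positivity
    rw [← div_lt_iff₀ hden]
    refine iff_of_eq (congrArg (· < γ) ?_)
    generalize q * (a * x) + q * b * (v / x) + 1 = F at *
    generalize a * x + b * z = E at *
    rw [div_eq_div_iff (by positivity) hden.ne']
    field_simp
  · rw [mrcFactorSq, relayPower]; positivity

/-- The amplified-power term alone forces outage: its numerator contains the whole received power A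
+ V + 1, with A the signal and V the interference part, and the hypothesis makes its coefficient at
least 1. Interference only helps, so V needs no estimate beyond its sign. -/
lemma mrcSinr_lt_of_mul_lt (hS : S.Admissible) {a b γ m : ℝ} (ha : 0 < a) (hb : 0 < b)
    (hγ : 0 < γ) {h₁ hI h₂ : Fin N → ℂ} (h1 : 0 < normSqVec h₁) (h2 : 0 < normSqVec h₂)
    (hm : normSqVec hI ≤ m)
    (h : normSqVec h₂ * (a * normSqVec h₁ + b * m) < γ * S.d₂ ^ S.τ / (S.η * S.θ)) :
    S.mrcSinr (a * S.d₁ ^ S.τ * S.N₀) (b * S.dI ^ S.τ * S.N₀) h₁ hI h₂ < γ := by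
  rw [mrcSinr_lt_iff S hS ha hb h1 h2]
  obtain ⟨hθ, hθ1, hη, hd₁, hd₂, hdI, hN₀⟩ := hS
  have hq : 0 < 1 - S.θ := by linarith
  have hZ := normSqVec_nonneg hI
  have hV : 0 ≤ (1 - S.θ) * b * (‖star h₁ ⬝ᵥ hI‖ ^ 2 / normSqVec h₁) := by positivity
  have hD₂ : 0 < S.d₂ ^ S.τ := Real.rpow_pos_of_pos hd₂ _
  have hE : 0 < normSqVec h₂ * (a * normSqVec h₁ + b * normSqVec hI) := by positivity
  have h' : normSqVec h₂ * (a * normSqVec h₁ + b * normSqVec hI) <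
      γ * S.d₂ ^ S.τ / (S.η * S.θ) := by
    refine lt_of_le_of_lt ?_ h
    gcongr
  have hax : 0 < (1 - S.θ) * (a * normSqVec h₁) := by positivity
  generalize (1 - S.θ) * b * (‖star h₁ ⬝ᵥ hI‖ ^ 2 / normSqVec h₁) = V at *
  generalize (1 - S.θ) * (a * normSqVec h₁) = A at *
  generalize normSqVec h₂ * (a * normSqVec h₁ + b * normSqVec hI) = E at *
  rw [lt_div_iff₀ (by positivity)] at h'
  have h3 : A + V + 1 ≤ γ * (S.d₂ ^ S.τ * (A + V + 1) / (S.η * S.θ * E)) := by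
    rw [← mul_div_assoc, le_div_iff₀ (by positivity)]
    nlinarith
  have : 0 < γ * (V + 1) := by positivity
  linarith

/-- With A = aX, the domination hypothesis gives V + 1 ≤ A/s, where V is the combined interference.
Replacing V + 1 by A/s and dropping the energy harvested from the interferer leaves an inequality
linear in A, which is solved for the product; the correction factor tends to 1 as s grows. -/
lemma mul_lt_of_mrcSinr_lt (hS : S.Admissible) {a b γ s : ℝ} (ha : 0 < a) (hb : 0 < b)
    (hγ : 0 < γ) {h₁ hI h₂ : Fin N → ℂ} (h1 : 0 < normSqVec h₁) (h2 : 0 < normSqVec h₂)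
    (hs : 0 < s) (hsγ : γ / s < 1 - S.θ)
    (hx : s * (1 + (1 - S.θ) * b * normSqVec hI) < a * normSqVec h₁)
    (h : S.mrcSinr (a * S.d₁ ^ S.τ * S.N₀) (b * S.dI ^ S.τ * S.N₀) h₁ hI h₂ < γ) :
    a * normSqVec h₁ * normSqVec h₂ <
      γ * S.d₂ ^ S.τ / (S.η * S.θ) * ((1 - S.θ + 1 / s) / (1 - S.θ - γ / s)) := by
  rw [mrcSinr_lt_iff S hS ha hb h1 h2] at h
  obtain ⟨hθ, hθ1, hη, hd₁, hd₂, hdI, hN₀⟩ := hS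
  have hq : 0 < 1 - S.θ := by linarith
  have hZ := normSqVec_nonneg hI
  have hV : 0 ≤ (1 - S.θ) * b * (‖star h₁ ⬝ᵥ hI‖ ^ 2 / normSqVec h₁) := by positivity
  have hVZ : (1 - S.θ) * b * (‖star h₁ ⬝ᵥ hI‖ ^ 2 / normSqVec h₁) ≤
      (1 - S.θ) * b * normSqVec hI := by
    gcongr
    rw [div_le_iff₀ h1, mul_comm]
    exact norm_dotProduct_star_sq_le _ _
  have hD₂ : 0 < S.d₂ ^ S.τ := Real.rpow_pos_of_pos hd₂ _
  have hX : 0 < a * normSqVec h₁ := by positivity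
  have hbz : 0 ≤ b * normSqVec hI := by positivity
  generalize (1 - S.θ) * b * (‖star h₁ ⬝ᵥ hI‖ ^ 2 / normSqVec h₁) = V at *
  generalize a * normSqVec h₁ = A at *
  generalize normSqVec h₂ = y at *
  have hu : V + 1 ≤ A / s := by rw [le_div_iff₀ hs]; nlinarith
  have h3 : S.d₂ ^ S.τ * ((1 - S.θ) * A + V + 1) / (S.η * S.θ * (y * (A + b * normSqVec hI))) ≤
      S.d₂ ^ S.τ * ((1 - S.θ) * A + A / s) / (S.η * S.θ * (y * A)) := by
    gcongr S.d₂ ^ S.τ * ?_ / (S.η * S.θ * (y * ?_))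
    · linarith
    · linarith
  have h4 : (1 - S.θ) * A < γ * (A / s +
      S.d₂ ^ S.τ * ((1 - S.θ) * A + A / s) / (S.η * S.θ * (y * A))) :=
    h.trans_le (by gcongr)
  have h5 : S.d₂ ^ S.τ * ((1 - S.θ) * A + A / s) / (S.η * S.θ * (y * A)) =
      S.d₂ ^ S.τ * (1 - S.θ + 1 / s) / (S.η * S.θ * y) := by
    field_simp
  rw [h5] at h4
  have hpos : 0 < 1 - S.θ - γ / s := by linarith
  have h6 : A * (1 - S.θ - γ / s) <
      γ * (S.d₂ ^ S.τ * (1 - S.θ + 1 / s)) / (S.η * S.θ * y) := by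
    have e1 : γ * (A / s) = A * (γ / s) := by ring
    rw [mul_add, e1] at h4
    rw [mul_div_assoc]
    linarith
  rw [lt_div_iff₀ (by positivity)] at h6
  rw [div_mul_div_comm, lt_div_iff₀ (by positivity)]
  linarith

end RelaySystem

/-! ### The logarithmic singularity of the hypergeometric sum. -/

/-- Partial fractions of `m! / (x (x + 1) ⋯ (x + m))`. -/
lemma sum_choose_neg_one_pow_div (m : ℕ) {x : ℝ} (hx : 0 < x) :
    ∑ k ∈ Finset.range (m + 1), (m.choose k : ℝ) * (-1) ^ k / (x + k) =
      m.factorial / ∏ k ∈ Finset.range (m + 1), (x + k) := by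
  induction m generalizing x with
  | zero => simp
  | succ m ih =>
    -- Pascal's rule: the sum for m + 1 at x is the difference of the sums for m at x and at x + 1.
    have h1 : ∑ k ∈ Finset.range (m + 2), ((m + 1).choose k : ℝ) * (-1) ^ k / (x + k) =
        (∑ k ∈ Finset.range (m + 1), (m.choose k : ℝ) * (-1) ^ k / (x + k)) -
          ∑ k ∈ Finset.range (m + 1), (m.choose k : ℝ) * (-1) ^ k / (x + 1 + k) := by
      have h2 : ∑ k ∈ Finset.range (m + 1), (m.choose k : ℝ) * (-1) ^ k / (x + k) =
          ∑ k ∈ Finset.range (m + 2), (m.choose k : ℝ) * (-1) ^ k / (x + k) := by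
        rw [Finset.sum_range_succ _ (m + 1)]; simp
      rw [h2, Finset.sum_range_succ' _ (m + 1), Finset.sum_range_succ' _ (m + 1),
        add_sub_right_comm, ← Finset.sum_sub_distrib]
      congr 1
      · refine Finset.sum_congr rfl fun k _ => ?_
        rw [Nat.choose_succ_succ]
        push_cast
        rw [show x + 1 + (k : ℝ) = x + (k + 1) by ring]
        ring
      · simp
    rw [h1, ih hx, ih (by linarith : 0 < x + 1)]
    have hp : ∏ k ∈ Finset.range (m + 1), (x + (k : ℝ)) =
        x * ∏ k ∈ Finset.range m, (x + 1 + (k : ℝ)) := by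
      rw [Finset.prod_range_succ', mul_comm]
      simp only [Nat.cast_zero, add_zero, Nat.cast_add, Nat.cast_one]
      congr 1
      exact Finset.prod_congr rfl fun k _ => by ring
    have hp2 : ∏ k ∈ Finset.range (m + 2), (x + (k : ℝ)) =
        x * ∏ k ∈ Finset.range (m + 1), (x + 1 + (k : ℝ)) := by
      rw [Finset.prod_range_succ', mul_comm]
      simp only [Nat.cast_zero, add_zero, Nat.cast_add, Nat.cast_one]
      congr 1
      exact Finset.prod_congr rfl fun k _ => by ring
    rw [hp2, hp, Finset.prod_range_succ _ m, Nat.factorial_succ]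
    have hP : ∏ k ∈ Finset.range m, (x + 1 + (k : ℝ)) ≠ 0 :=
      Finset.prod_ne_zero_iff.2 fun k _ => by positivity
    have hxm : x + 1 + (m : ℝ) ≠ 0 := by positivity
    have hx0 : x ≠ 0 := hx.ne'
    push_cast
    field_simp
    ring

lemma ascPochhammer_eval_div_eval_add_one {b : ℝ} (hb : 0 < b) (n : ℕ) :
    (ascPochhammer ℝ n).eval b / (ascPochhammer ℝ n).eval (b + 1) = b / (b + n) := by
  induction n with
  | zero => simp [hb.ne']
  | succ n ih =>
    rw [ascPochhammer_succ_eval, ascPochhammer_succ_eval, mul_div_mul_comm, ih]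
    have : b + (n : ℝ) ≠ 0 := by positivity
    have : b + 1 + (n : ℝ) ≠ 0 := by positivity
    have : b + ((n + 1 : ℕ) : ℝ) ≠ 0 := by positivity
    push_cast at *
    field_simp
    ring

/-- The power series of `₂F₁(a, b; b + 1; z) / b`. -/
lemma hasSum_ordinaryHypergeometric_div {a b z : ℝ} (ha : 0 < a) (hb : 0 < b) (hz : |z| < 1) :
    HasSum (fun n : ℕ => (ascPochhammer ℝ n).eval a / n.factorial / (b + n) * z ^ n)
      (ordinaryHypergeometric a b (b + 1) z / b) := by
  have hr : (ordinaryHypergeometricSeries ℝ a b (b + 1)).radius = 1 :=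
    ordinaryHypergeometricSeries_radius_eq_one ℝ a b (b + 1) fun k => by
      have : (0 : ℝ) ≤ k := k.cast_nonneg
      refine ⟨?_, ?_, ?_⟩ <;> intro h <;> linarith
  have hz' : z ∈ Metric.eball (0 : ℝ) (ordinaryHypergeometricSeries ℝ a b (b + 1)).radius := by
    rw [hr]
    simpa [enorm_eq_nnnorm, ← NNReal.coe_lt_coe] using hz
  have h := ((ordinaryHypergeometricSeries ℝ a b (b + 1)).hasSum hz').div_const b
  refine h.congr_fun fun n => ?_
  rw [ordinaryHypergeometricSeries_apply_eq, smul_eq_mul]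
  have h1 := ascPochhammer_eval_div_eval_add_one hb n
  rw [mul_assoc _ _ (_⁻¹), ← div_eq_mul_inv, h1]
  field_simp

/-- The coefficients of the power series of `∫₀¹ t^m (1 - t)^m (1 - z t)^(-m-1) dt`. -/
noncomputable def betaKernelCoeff (m n : ℕ) : ℝ :=
  (ascPochhammer ℝ n).eval ((m : ℝ) + 1) / n.factorial *
    (m.factorial / ∏ k ∈ Finset.range (m + 1), ((m : ℝ) + 1 + n + k))

lemma hasSum_sum_ordinaryHypergeometric (m : ℕ) {z : ℝ} (hz : |z| < 1) :
    HasSum (fun n => betaKernelCoeff m n * z ^ n)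
      (∑ k ∈ Finset.range (m + 1), (m.choose k : ℝ) * (-1) ^ k *
        (ordinaryHypergeometric ((m : ℝ) + 1) ((m : ℝ) + 1 + k) ((m : ℝ) + 1 + k + 1) z /
          ((m : ℝ) + 1 + k))) := by
  have h := hasSum_sum (s := Finset.range (m + 1)) fun k _ =>
    (hasSum_ordinaryHypergeometric_div (a := (m : ℝ) + 1) (b := (m : ℝ) + 1 + k) (by positivity)
      (by positivity) hz).mul_left ((m.choose k : ℝ) * (-1) ^ k)
  refine h.congr_fun fun n => ?_
  rw [betaKernelCoeff, ← sum_choose_neg_one_pow_div m (by positivity), Finset.mul_sum,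
    Finset.sum_mul]
  refine Finset.sum_congr rfl fun k _ => ?_
  rw [add_right_comm ((m : ℝ) + 1)]
  ring

/-- Both sides of (m+1)_n · m! = n! · (n+1)⋯(n+m) equal (m+n)!. This turns the coefficient into m
ratios, each at most 1 and tending to 1 with n, over a linear factor, from which both bounds below
can be read off. -/
lemma betaKernelCoeff_eq (m n : ℕ) :
    betaKernelCoeff m n = (∏ k ∈ Finset.range m, (((n : ℝ) + 1 + k) / (m + 1 + n + k))) /
      (2 * m + 1 + n) := by
  have h1 : (ascPochhammer ℝ n).eval ((m : ℝ) + 1) * m.factorial =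
      n.factorial * ∏ k ∈ Finset.range m, ((n : ℝ) + 1 + k) := by
    have e1 : (ascPochhammer ℝ n).eval ((m : ℝ) + 1) * m.factorial = ((m + n).factorial : ℝ) := by
      have := Nat.factorial_mul_ascFactorial m n
      rw [← this, ← ascPochhammer_nat_eq_ascFactorial, Nat.cast_mul, ascPochhammer_eval_cast]
      push_cast; ring
    have e2 : (n.factorial : ℝ) * ∏ k ∈ Finset.range m, ((n : ℝ) + 1 + k) =
        ((n + m).factorial : ℝ) := by
      rw [← Nat.factorial_mul_ascFactorial n m, Nat.ascFactorial_eq_prod_range]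
      push_cast; rfl
    rw [e1, e2, add_comm]
  have hP : ∏ k ∈ Finset.range m, ((m : ℝ) + 1 + n + k) ≠ 0 :=
    Finset.prod_ne_zero_iff.2 fun k _ => by positivity
  have hn : (n.factorial : ℝ) ≠ 0 := by positivity
  rw [betaKernelCoeff, Finset.prod_div_distrib, Finset.prod_range_succ, div_mul_div_comm, h1]
  rw [show (m : ℝ) + 1 + n + m = 2 * m + 1 + n by ring]
  have : (2 * m + 1 + n : ℝ) ≠ 0 := by positivity
  field_simp

lemma betaKernelCoeff_nonneg (m n : ℕ) : 0 ≤ betaKernelCoeff m n := by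
  rw [betaKernelCoeff_eq]; positivity

lemma betaKernelCoeff_le (m n : ℕ) : betaKernelCoeff m n ≤ 1 / ((n : ℝ) + 1) := by
  rw [betaKernelCoeff_eq]
  have hm : (0 : ℝ) ≤ m := m.cast_nonneg
  refine div_le_div₀ zero_le_one ?_ (by positivity) (by linarith)
  refine Finset.prod_le_one (fun k _ => by positivity) fun k _ => ?_
  rw [div_le_one (by positivity)]
  linarith

/-- With w = n + 1, each of the m ratios is at least 1 - m/w, so Bernoulli bounds the product below
by 1 - m²/w; replacing w + 2m by w accounts for the remaining 2m/w². If w ≤ m the left side is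
nonpositive. -/
lemma le_betaKernelCoeff (m n : ℕ) :
    1 / ((n : ℝ) + 1) - (m ^ 2 + 2 * m) / ((n : ℝ) + 1) ^ 2 ≤ betaKernelCoeff m n := by
  have hm : (0 : ℝ) ≤ m := m.cast_nonneg
  set w : ℝ := (n : ℝ) + 1
  have hw : 0 < w := by positivity
  by_cases hmw : w ≤ m
  · refine le_trans ?_ (betaKernelCoeff_nonneg m n)
    rw [sub_nonpos, div_le_div_iff₀ hw (by positivity)]
    nlinarith
  · push Not at hmw
    have h1 : 1 - m * (m / w) ≤ ∏ k ∈ Finset.range m, (((n : ℝ) + 1 + k) / (m + 1 + n + k)) := by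
      calc 1 - m * (m / w) = 1 + m * (-(m / w)) := by ring
        _ ≤ (1 + -(m / w)) ^ m := by
            refine one_add_mul_le_pow ?_ m
            have : m / w ≤ 1 := by rw [div_le_one hw]; exact hmw.le
            linarith
        _ = ∏ k ∈ Finset.range m, (1 + -((m : ℝ) / w)) := by simp
        _ ≤ _ := by
            refine Finset.prod_le_prod (fun k _ => ?_) fun k _ => ?_
            · have : m / w ≤ 1 := by rw [div_le_one hw]; exact hmw.le
              linarith
            · have hk : (0 : ℝ) ≤ k := k.cast_nonneg
              rw [show (m : ℝ) + 1 + n + k = m + (w + k) by simp only [w]; ring,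
                show (n : ℝ) + 1 + k = w + k from rfl, le_div_iff₀ (by positivity)]
              have e : m / w * w = m := div_mul_cancel₀ _ hw.ne'
              have : 0 ≤ m / w := by positivity
              nlinarith [mul_nonneg this hk, mul_nonneg this hm]
    rw [betaKernelCoeff_eq, show (2 * m + 1 + n : ℝ) = w + 2 * m by simp only [w]; ring]
    calc 1 / w - (m ^ 2 + 2 * m) / w ^ 2 ≤ (1 - m * (m / w)) / (w + 2 * m) := by
          rw [le_div_iff₀ (by positivity)]
          have : (1 / w - (m ^ 2 + 2 * m) / w ^ 2) * (w + 2 * m) =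
            1 - m * (m / w) - (m ^ 2 + 2 * m) * (2 * m) / w ^ 2 := by
              field_simp
              ring
          rw [this]
          have : 0 ≤ (m ^ 2 + 2 * m) * (2 * m) / w ^ 2 := by positivity
          linarith
      _ ≤ _ := by gcongr

/-- The logarithmic singularity at `1` of a power series with coefficients close to `1/(n+1)`. -/
lemma tendsto_hasSum_betaKernelCoeff_div_log (m : ℕ) {H : ℝ → ℝ}
    (hH : ∀ z, |z| < 1 → HasSum (fun n => betaKernelCoeff m n * z ^ n) (H z)) :
    Tendsto (fun ε => H (1 - ε) / -Real.log ε) (𝓝[>] 0) (𝓝 1) := by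
  set K : ℝ := ∑' n : ℕ, ((m : ℝ) ^ 2 + 2 * m) / ((n : ℝ) + 1) ^ 2
  have hK : Summable fun n : ℕ => ((m : ℝ) ^ 2 + 2 * m) / ((n : ℝ) + 1) ^ 2 := by
    have := (summable_nat_add_iff 1).2 (Real.summable_one_div_nat_pow.2 (one_lt_two))
    refine (this.mul_left ((m : ℝ) ^ 2 + 2 * m)).congr fun n => ?_
    push_cast; ring
  have hlog : Tendsto (fun ε : ℝ => -Real.log ε) (𝓝[>] 0) atTop :=
    tendsto_neg_atBot_atTop.comp Real.tendsto_log_nhdsGT_zero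
  have hε : Tendsto (fun ε : ℝ => 1 - ε) (𝓝[>] 0) (𝓝 1) := by
    have : Tendsto (fun ε : ℝ => 1 - ε) (𝓝 0) (𝓝 (1 - 0)) :=
      (continuous_const.sub continuous_id).tendsto 0
    rw [sub_zero] at this
    exact this.mono_left nhdsWithin_le_nhds
  have hlo : Tendsto (fun ε : ℝ => 1 / (1 - ε) - K / -Real.log ε) (𝓝[>] 0) (𝓝 1) := by
    have h1 := (tendsto_const_nhds (x := (1 : ℝ))).div hε one_ne_zero
    have h2 := (tendsto_const_nhds (x := K)).div_atTop hlog
    simpa using h1.sub h2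
  have hhi : Tendsto (fun ε : ℝ => 1 / (1 - ε)) (𝓝[>] 0) (𝓝 1) := by
    have h := (tendsto_const_nhds (x := (1 : ℝ))).div hε one_ne_zero
    rw [div_one] at h
    exact h
  have hev : ∀ᶠ ε : ℝ in 𝓝[>] 0, 0 < ε ∧ ε < 1 :=
    Ioo_mem_nhdsGT zero_lt_one
  -- Comparison with ∑ zⁿ/(n+1) = -log(1-z)/z at z = 1 - ε; the error coefficients are summable, so
  -- they cost at most the constant K, uniformly in ε.
  have key : ∀ ε : ℝ, 0 < ε → ε < 1 → -Real.log ε / (1 - ε) - K ≤ H (1 - ε) ∧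
      H (1 - ε) ≤ -Real.log ε / (1 - ε) := by
    intro ε h0 h1
    have hz0 : 0 < 1 - ε := by linarith
    have hz : |1 - ε| < 1 := by rw [abs_of_pos hz0]; linarith
    have hL : HasSum (fun n : ℕ => 1 / ((n : ℝ) + 1) * (1 - ε) ^ n) (-Real.log ε / (1 - ε)) := by
      have := (Real.hasSum_pow_div_log_of_abs_lt_one hz).div_const (1 - ε)
      rw [sub_sub_cancel] at this
      refine this.congr_fun fun n => ?_
      rw [pow_succ]
      field_simp
    constructor
    · refine hasSum_le (fun n => ?_) (hL.sub hK.hasSum) (hH _ hz)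
      have hp : (1 - ε) ^ n ≤ 1 := pow_le_one₀ hz0.le (by linarith)
      have hp0 : 0 ≤ (1 - ε) ^ n := by positivity
      have := mul_le_mul_of_nonneg_right (le_betaKernelCoeff m n) hp0
      rw [sub_mul] at this
      have h3 : ((m : ℝ) ^ 2 + 2 * m) / ((n : ℝ) + 1) ^ 2 * (1 - ε) ^ n ≤
        ((m : ℝ) ^ 2 + 2 * m) / ((n : ℝ) + 1) ^ 2 := mul_le_of_le_one_right (by positivity) hp
      linarith
    · refine hasSum_le (fun n => ?_) (hH _ hz) hL
      exact mul_le_mul_of_nonneg_right (betaKernelCoeff_le m n) (by positivity)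
  refine tendsto_of_tendsto_of_tendsto_of_le_of_le' hlo hhi ?_ ?_
  · filter_upwards [hev] with ε ⟨h0, h1⟩
    have hl : 0 < -Real.log ε := neg_pos.2 (Real.log_neg h0 h1)
    rw [le_div_iff₀ hl, sub_mul, div_mul_cancel₀ _ hl.ne']
    have := (key ε h0 h1).1
    rwa [one_div_mul_eq_div]
  · filter_upwards [hev] with ε ⟨h0, h1⟩
    have hl : 0 < -Real.log ε := neg_pos.2 (Real.log_neg h0 h1)
    rw [div_le_iff₀ hl, one_div_mul_eq_div]
    exact (key ε h0 h1).2

/-! ### Two-sided bounds and leading order of the outage probability. -/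

lemma IsRayleighFading.ae_gains_pos {Ω : Type*} [MeasurableSpace Ω] {μ : Measure Ω} {N : ℕ}
    (hN : 1 ≤ N) {h₁ hI h₂ : Ω → Fin N → ℂ} (h : IsRayleighFading μ h₁ hI h₂) :
    ∀ᵐ ω ∂μ, 0 < normSqVec (h₁ ω) ∧ 0 < normSqVec (h₂ ω) := by
  have hX : HasLaw (fun ω => normSqVec (h₁ ω)) (gainLaw N) μ :=
    measurePreserving_fst.fun_comp_hasLaw h.hasLaw_gains
  have hZY : HasLaw (fun ω => (normSqVec (hI ω), normSqVec (h₂ ω)))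
      ((gainLaw N).prod (gainLaw N)) μ :=
    measurePreserving_snd.fun_comp_hasLaw h.hasLaw_gains
  have hY : HasLaw (fun ω => normSqVec (h₂ ω)) (gainLaw N) μ :=
    measurePreserving_snd.fun_comp_hasLaw hZY
  have hp : Measurable (fun x : ℝ => 0 < x) := measurableSet_setOfPred.1 measurableSet_Ioi
  exact ((hX.ae_iff hp).2 (ae_gainLaw_pos hN)).and ((hY.ae_iff hp).2 (ae_gainLaw_pos hN))

namespace RelaySystem

variable (S : RelaySystem) {N : ℕ}

/-- A union bound: either the source gain fails to dominate the interference, or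
`mul_lt_of_mrcSinr_lt` bounds the product of gains. In the second case s ≥ 1 supplies the cut-off 1
< aX. -/
lemma mrcOutage_le {Ω : Type*} [MeasurableSpace Ω] {μ : Measure Ω} (hN : 1 ≤ N)
    {h₁ hI h₂ : Ω → Fin N → ℂ} (hf : IsRayleighFading μ h₁ hI h₂) (hS : S.Admissible)
    {a b γ s : ℝ} (ha : 1 ≤ a) (hb : 0 < b) (hγ : 0 < γ) (hs : 1 ≤ s) (hsγ : γ / s < 1 - S.θ) :
    S.mrcOutage μ h₁ hI h₂ γ (b * S.dI ^ S.τ) (a * S.d₁ ^ S.τ) ≤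
      (s / a) ^ N / N.factorial *
        (∫⁻ z, ENNReal.ofReal ((1 + (1 - S.θ) * b * z) ^ N) ∂(gainLaw N)).toReal +
      ((γ * S.d₂ ^ S.τ / (S.η * S.θ) * ((1 - S.θ + 1 / s) / (1 - S.θ - γ / s))) / a) ^ N /
        (N.factorial * (N - 1).factorial) * (Real.log a + 1) := by
  have hq : 0 < 1 - S.θ := by linarith [hS.θ_lt_one]
  have hD₂ : 0 < S.d₂ ^ S.τ := Real.rpow_pos_of_pos hS.d₂_pos _
  have hpos : 0 < 1 - S.θ - γ / s := by linarith
  have hη := hS.η_pos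
  have hθ := hS.θ_pos
  have hlog := Real.log_nonneg ha
  set κ := γ * S.d₂ ^ S.τ / (S.η * S.θ) * ((1 - S.θ + 1 / s) / (1 - S.θ - γ / s))
  have hκ : 0 ≤ κ := by positivity
  set M := ∫⁻ z, ENNReal.ofReal ((1 + (1 - S.θ) * b * z) ^ N) ∂(gainLaw N)
  have hM : M ≠ ⊤ := (lintegral_gainLaw_affine_pow_lt_top hN _).ne
  set B₁ : Set (ℝ × ℝ) := {p | a * p.1 ≤ s * (1 + (1 - S.θ) * b * p.2)}
  set B₂ : Set (ℝ × ℝ) := {p | 1 < a * p.1 ∧ a * p.1 * p.2 < κ}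
  have hB₁ : MeasurableSet B₁ := measurableSet_le (by fun_prop) (by fun_prop)
  have hB₂ : MeasurableSet B₂ :=
    have h1 : MeasurableSet {p : ℝ × ℝ | 1 < a * p.1} :=
      measurableSet_lt (by fun_prop) (by fun_prop)
    have h2 : MeasurableSet {p : ℝ × ℝ | a * p.1 * p.2 < κ} :=
      measurableSet_lt (by fun_prop) (by fun_prop)
    h1.inter h2
  have hg := hf.hasLaw_gains
  refine ENNReal.toReal_le_of_le_ofReal (by positivity) ?_
  calc μ {ω | S.mrcSinr (a * S.d₁ ^ S.τ * S.N₀) (b * S.dI ^ S.τ * S.N₀) (h₁ ω) (hI ω) (h₂ ω) < γ}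
      ≤ μ ({ω | (normSqVec (h₁ ω), normSqVec (hI ω)) ∈ B₁} ∪
          {ω | normSqVec (hI ω) ∈ Set.univ ∧ (normSqVec (h₁ ω), normSqVec (h₂ ω)) ∈ B₂}) := by
        refine measure_mono_ae ?_
        filter_upwards [hf.ae_gains_pos hN] with ω hω hout
        by_cases hx : a * normSqVec (h₁ ω) ≤ s * (1 + (1 - S.θ) * b * normSqVec (hI ω))
        · exact Or.inl hx
        · push Not at hx
          have hz : 0 ≤ (1 - S.θ) * b * normSqVec (hI ω) := by
            have := normSqVec_nonneg (hI ω)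
            positivity
          refine Or.inr ⟨trivial, ?_, ?_⟩
          · show 1 < a * normSqVec (h₁ ω)
            nlinarith
          · exact S.mul_lt_of_mrcSinr_lt hS (by linarith) hb hγ hω.1 hω.2 (by linarith) hsγ hx hout
    _ ≤ ((gainLaw N).prod (gainLaw N)) B₁ + ((gainLaw N).prod (gainLaw N)) B₂ := by
        refine (measure_union_le _ _).trans_eq ?_
        rw [gains_hasLaw_fst_snd hg hB₁, gains_hasLaw_prod_and hg MeasurableSet.univ hB₂,
          measure_univ, one_mul]
    _ ≤ ENNReal.ofReal ((s / a) ^ N / N.factorial) * M +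
        ENNReal.ofReal ((κ / a) ^ N / (N.factorial * (N - 1).factorial) * (Real.log a + 1)) :=
        add_le_add (gainLaw_prod_le_affine hN (by linarith) (by positivity) (by linarith))
          (gainLaw_prod_mul_lt_le hN ha hκ)
    _ = _ := by
        rw [ENNReal.ofReal_add (by positivity) (by positivity),
          ENNReal.ofReal_mul (p := (s / a) ^ N / N.factorial) (by positivity),
            ENNReal.ofReal_toReal hM]

/-- Restricting to interferer gains at most m makes the sufficient criterion an event in the other
two gains, and independence factors the probability. -/
lemma le_mrcOutage {Ω : Type*} [MeasurableSpace Ω] {μ : Measure Ω} (hN : 1 ≤ N)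
    {h₁ hI h₂ : Ω → Fin N → ℂ} (hf : IsRayleighFading μ h₁ hI h₂) (hS : S.Admissible)
    {a b γ s m : ℝ} (hb : 0 < b) (hγ : 0 < γ) (hs : 1 ≤ s) (hsa : s ^ 2 ≤ a) (hm : 0 ≤ m) :
    (gainLaw N).real (Set.Iic m) *
      (Real.exp (-(γ * S.d₂ ^ S.τ / (S.η * S.θ) / s)) * Real.exp (-(1 / s)) *
        ((γ * S.d₂ ^ S.τ / (S.η * S.θ) / (1 + b * m / s)) / a) ^ N /
        (N.factorial * (N - 1).factorial) * Real.log (a / s ^ 2)) ≤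
    S.mrcOutage μ h₁ hI h₂ γ (b * S.dI ^ S.τ) (a * S.d₁ ^ S.τ) := by
  have hD₂ : 0 < S.d₂ ^ S.τ := Real.rpow_pos_of_pos hS.d₂_pos _
  have hη := hS.η_pos
  have hθ := hS.θ_pos
  have ha : 0 < a := by nlinarith
  set κ := γ * S.d₂ ^ S.τ / (S.η * S.θ)
  have hκ : 0 ≤ κ := by positivity
  have hg := hf.hasLaw_gains
  have : IsProbabilityMeasure μ := hg.isProbabilityMeasure
  have hB : MeasurableSet {p : ℝ × ℝ | p.2 * (a * p.1 + b * m) < κ} :=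
    measurableSet_lt (by fun_prop) (by fun_prop)
  have hle := le_gainLaw_prod_mul_lt hN hκ (by positivity : 0 ≤ b * m) hs hsa
  have hle' := mul_le_mul_right hle (gainLaw N (Set.Iic m))
  rw [← gains_hasLaw_prod_and hg measurableSet_Iic hB] at hle'
  have h2 : μ {ω | normSqVec (hI ω) ∈ Set.Iic m ∧
      (normSqVec (h₁ ω), normSqVec (h₂ ω)) ∈ {p : ℝ × ℝ | p.2 * (a * p.1 + b * m) < κ}} ≤
      μ {ω | S.mrcSinr (a * S.d₁ ^ S.τ * S.N₀) (b * S.dI ^ S.τ * S.N₀)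
        (h₁ ω) (hI ω) (h₂ ω) < γ} := by
    refine measure_mono_ae ?_
    filter_upwards [hf.ae_gains_pos hN] with ω hω h
    exact S.mrcSinr_lt_of_mul_lt hS ha hb hγ hω.1 hω.2 h.1 h.2
  have h3 := ENNReal.toReal_mono (measure_ne_top _ _) (hle'.trans h2)
  have hl : 0 ≤ Real.log (a / s ^ 2) :=
    Real.log_nonneg ((one_le_div (by positivity)).2 hsa)
  rw [ENNReal.toReal_mul, ENNReal.toReal_ofReal (by positivity)] at h3
  exact h3

/-- The leading coefficient of the outage probability of the MRC/MRT scheme. -/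
noncomputable def mrcOutageCoeff (N : ℕ) (γ : ℝ) : ℝ :=
  (γ * S.d₂ ^ S.τ / (S.η * S.θ)) ^ N / (N.factorial * (N - 1).factorial)

lemma mrcOutageCoeff_pos (hS : S.Admissible) {γ : ℝ} (hγ : 0 < γ) : 0 < S.mrcOutageCoeff N γ := by
  have hD₂ : 0 < S.d₂ ^ S.τ := Real.rpow_pos_of_pos hS.d₂_pos _
  have hη := hS.η_pos
  have hθ := hS.θ_pos
  unfold mrcOutageCoeff
  positivity

/-- The leading order behaviour of the outage probability. -/
lemma tendsto_mrcOutage_mul_pow_div_log {Ω : Type*} [MeasurableSpace Ω] {μ : Measure Ω}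
    (hN : 1 ≤ N) {h₁ hI h₂ : Ω → Fin N → ℂ} (hf : IsRayleighFading μ h₁ hI h₂)
    (hS : S.Admissible) {b γ : ℝ} (hb : 0 < b) (hγ : 0 < γ) :
    Tendsto (fun a => S.mrcOutage μ h₁ hI h₂ γ (b * S.dI ^ S.τ) (a * S.d₁ ^ S.τ) * a ^ N /
      Real.log a) atTop (𝓝 (S.mrcOutageCoeff N γ)) := by
  have hq : 0 < 1 - S.θ := by linarith [hS.θ_lt_one]
  set κ := γ * S.d₂ ^ S.τ / (S.η * S.θ) with hκd
  set F : ℝ := N.factorial * (N - 1).factorial with hF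
  set M := (∫⁻ z, ENNReal.ofReal ((1 + (1 - S.θ) * b * z) ^ N) ∂(gainLaw N)).toReal with hMd
  have hF0 : F ≠ 0 := by positivity
  have hC : S.mrcOutageCoeff N γ = κ ^ N / F := rfl
  have hinv : Tendsto (fun s : ℝ => 1 / s) atTop (𝓝 0) := by
    simpa using tendsto_inv_atTop_zero (𝕜 := ℝ)
  have hinvc (c : ℝ) : Tendsto (fun s : ℝ => c / s) atTop (𝓝 0) :=
    tendsto_const_nhds.div_atTop tendsto_id
  have hpow : Tendsto (fun s : ℝ => s ^ (2 * N)) atTop atTop := tendsto_pow_atTop (by omega)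
  set U : ℝ → ℝ := fun s => M / N.factorial / s ^ N +
    (κ * ((1 - S.θ + 1 / s) / (1 - S.θ - γ / s))) ^ N / F * (1 + 1 / s ^ (2 * N))
  set W : ℝ → ℝ := fun s => (gainLaw N).real (Set.Iic √s) *
    (Real.exp (-(κ / s)) * Real.exp (-(1 / s)) * (κ / (1 + b / √s)) ^ N / F *
      (1 - 2 * (Real.log s / s ^ (2 * N))))
  have hU : Tendsto U atTop (𝓝 (κ ^ N / F)) := by
    have h1 : Tendsto (fun s : ℝ => M / N.factorial / s ^ N) atTop (𝓝 0) :=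
      tendsto_const_nhds.div_atTop (tendsto_pow_atTop (by omega))
    have h2 : Tendsto (fun s : ℝ => (1 - S.θ + 1 / s) / (1 - S.θ - γ / s)) atTop
        (𝓝 ((1 - S.θ + 0) / (1 - S.θ - 0))) :=
      (hinv.const_add _).div ((hinvc γ).const_sub _) (by simpa using hq.ne')
    have h3 : Tendsto (fun s : ℝ => 1 + 1 / s ^ (2 * N)) atTop (𝓝 (1 + 0)) :=
      (tendsto_const_nhds.div_atTop hpow).const_add _
    have h4 := h1.add ((((h2.const_mul κ).pow N).div_const F).mul h3)
    simpa [U, div_self hq.ne'] using h4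
  have hW : Tendsto W atTop (𝓝 (κ ^ N / F)) := by
    have h1 : Tendsto (fun s : ℝ => (gainLaw N).real (Set.Iic √s)) atTop (𝓝 1) := by
      have := (ENNReal.tendsto_toReal (measure_ne_top (gainLaw N) Set.univ)).comp
        (tendsto_measure_Iic_atTop (gainLaw N))
      rw [measure_univ, ENNReal.toReal_one] at this
      exact this.comp Real.tendsto_sqrt_atTop
    have h2 (c : ℝ) : Tendsto (fun s : ℝ => Real.exp (-(c / s))) atTop (𝓝 1) := by
      have := (Real.continuous_exp.tendsto _).comp (hinvc c).neg
      simpa [Function.comp_def] using this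
    have h3 : Tendsto (fun s : ℝ => 1 + b / √s) atTop (𝓝 (1 + 0)) :=
      (tendsto_const_nhds.div_atTop Real.tendsto_sqrt_atTop).const_add _
    have h4 : Tendsto (fun s : ℝ => Real.log s / s ^ (2 * N)) atTop (𝓝 0) := by
      have := (isLittleO_log_rpow_atTop (r := ((2 * N : ℕ) : ℝ)) (by positivity)).tendsto_div_nhds_zero
      simpa only [Real.rpow_natCast] using this
    have h5 : Tendsto (fun s : ℝ => κ / (1 + b / √s)) atTop (𝓝 (κ / (1 + 0))) :=
      tendsto_const_nhds.div h3 (by norm_num)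
    have h6 := h1.mul ((((h2 κ).mul (h2 1)).mul (h5.pow N)).div_const F |>.mul
      ((h4.const_mul 2).const_sub 1))
    simpa [W] using h6
  -- The cut-off satisfies s^(2N) = log a: it tends to infinity, yet s^N = √(log a) is negligible
  -- against log a.
  have hs : Tendsto (fun a : ℝ => Real.log a ^ (1 / ((2 * N : ℕ) : ℝ))) atTop atTop :=
    (tendsto_rpow_atTop (by positivity)).comp Real.tendsto_log_atTop
  rw [hC]
  refine tendsto_of_tendsto_of_tendsto_of_le_of_le' (hW.comp hs) (hU.comp hs) ?_ ?_
  all_goals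
    have hγs : ∀ᶠ s : ℝ in atTop, γ / s < 1 - S.θ := (hinvc γ).eventually_lt_const hq
    filter_upwards [hs.eventually hγs, hs.eventually_ge_atTop 1, eventually_gt_atTop 1]
      with a h1 h2 ha
    have hla : 0 < Real.log a := Real.log_pos ha
    have ha0 : 0 < a := by linarith
    simp only [Function.comp_apply]
    generalize hsd : Real.log a ^ (1 / ((2 * N : ℕ) : ℝ)) = s at *
    have hsl : s ^ (2 * N) = Real.log a := by
      rw [← hsd, one_div, Real.rpow_inv_natCast_pow hla.le (by omega)]
    have hs0 : 0 < s := by linarith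
  · have hsa : s ^ 2 ≤ a := by
      calc s ^ 2 ≤ s ^ (2 * N) := pow_le_pow_right₀ h2 (by omega)
        _ = Real.log a := hsl
        _ ≤ a := (Real.log_le_sub_one_of_pos ha0).trans (by linarith)
    -- The choice m = √s exhausts the law of the interferer gain while b m/s = b/√s still vanishes.
    have hmain := S.le_mrcOutage hN hf hS hb hγ h2 hsa (Real.sqrt_nonneg s)
    have hbs : b * √s / s = b / √s := by
      rw [mul_div_assoc, Real.sqrt_div_self]; rfl
    rw [Real.log_div ha0.ne' (by positivity), Real.log_pow, hbs, ← hκd, ← hF] at hmain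
    rw [le_div_iff₀ hla]
    refine le_trans (le_of_eq ?_) (mul_le_mul_of_nonneg_right hmain (by positivity : 0 ≤ a ^ N))
    simp only [W, hsl]
    rw [div_pow _ a]
    push_cast
    field_simp
  · have hmain := S.mrcOutage_le hN hf hS ha.le hb hγ h2 h1
    rw [← hκd, ← hF, ← hMd] at hmain
    rw [div_le_iff₀ hla]
    refine (mul_le_mul_of_nonneg_right hmain (by positivity : 0 ≤ a ^ N)).trans (le_of_eq ?_)
    have e : s ^ N * s ^ N = Real.log a := by rw [← hsl]; ring
    simp only [U, hsl]
    rw [div_pow s a, div_pow _ a, ← e]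
    field_simp

/-! ### Leading order of the approximation. -/

/-- The alternating sum of hypergeometric functions in the high-SNR approximation. -/
noncomputable def hypergeometricSum (m : ℕ) (z : ℝ) : ℝ :=
  ∑ k ∈ Finset.range (m + 1), (m.choose k : ℝ) * (-1) ^ k *
    (ordinaryHypergeometric ((m : ℝ) + 1) ((m : ℝ) + 1 + k) ((m : ℝ) + 1 + k + 1) z /
      ((m : ℝ) + 1 + k))

lemma sum_hypergeometric_reflect (m : ℕ) (z : ℝ) :
    ∑ i ∈ Finset.range (m + 1),
      (Nat.choose (m + 1 - 1) i : ℝ) * (-1) ^ (m + 1 - i - 1) *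
        (ordinaryHypergeometric ((m + 1 : ℕ) : ℝ) (2 * ((m + 1 : ℕ) : ℝ) - i - 1)
          (2 * ((m + 1 : ℕ) : ℝ) - i) z / (2 * ((m + 1 : ℕ) : ℝ) - i - 1)) =
      hypergeometricSum m z := by
  rw [hypergeometricSum, ← Finset.sum_range_reflect]
  refine Finset.sum_congr rfl fun k hk => ?_
  have hk' : k ≤ m := Nat.lt_succ_iff.1 (Finset.mem_range.1 hk)
  have e : m + 1 - 1 - k = m - k := by omega
  have e2 : m + 1 - (m - k) - 1 = k := by omega
  rw [e, e2, Nat.add_sub_cancel, Nat.choose_symm hk']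
  push_cast [Nat.cast_sub hk']
  rw [show 2 * ((m : ℝ) + 1) - (m - k) - 1 = m + 1 + k by ring,
    show 2 * ((m : ℝ) + 1) - (m - k) = m + 1 + k + 1 by ring]

/-- The finite sum contributes a constant, which vanishes after division by log a. The
hypergeometric argument is 1 - b/a, so the other part grows like log(a/b), which is asymptotic to
log a. -/
lemma tendsto_mrcOutageApprox_mul_pow_div_log (hN : 1 ≤ N) (hS : S.Admissible) {b γ : ℝ}
    (hb : 0 < b) :
    Tendsto (fun a => S.mrcOutageApprox N γ (b * S.dI ^ S.τ) (a * S.d₁ ^ S.τ) * a ^ N /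
      Real.log a) atTop (𝓝 (S.mrcOutageCoeff N γ)) := by
  obtain ⟨m, rfl⟩ : ∃ m, N = m + 1 := ⟨N - 1, by omega⟩
  have hD₁ : 0 < S.d₁ ^ S.τ := Real.rpow_pos_of_pos hS.d₁_pos _
  have hDI : 0 < S.dI ^ S.τ := Real.rpow_pos_of_pos hS.dI_pos _
  have hη := hS.η_pos
  have hθ := hS.θ_pos
  set A : ℝ := (1 / (1 - S.θ)) ^ (m + 1) * ∑ n ∈ Finset.range (m + 1 + 1),
    ((1 - S.θ) * (b * S.dI ^ S.τ)) ^ n /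
      (S.dI ^ ((n : ℝ) * S.τ) * (Nat.factorial (m + 1 - n) : ℝ)) with hA
  have hlim : Tendsto (fun a : ℝ => γ ^ (m + 1) * A / Real.log a + S.mrcOutageCoeff (m + 1) γ *
      ((hypergeometricSum m (1 - b / a) / -Real.log (b / a)) * (1 - Real.log b / Real.log a)))
      atTop (𝓝 (S.mrcOutageCoeff (m + 1) γ)) := by
    have h1 : Tendsto (fun a : ℝ => γ ^ (m + 1) * A / Real.log a) atTop (𝓝 0) :=
      tendsto_const_nhds.div_atTop Real.tendsto_log_atTop
    have h2 : Tendsto (fun a : ℝ => b / a) atTop (𝓝[>] 0) := by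
      refine tendsto_nhdsWithin_iff.2 ⟨tendsto_const_nhds.div_atTop tendsto_id, ?_⟩
      filter_upwards [eventually_gt_atTop 0] with a ha
      exact div_pos hb ha
    have h3 := (tendsto_hasSum_betaKernelCoeff_div_log m
      fun z hz => hasSum_sum_ordinaryHypergeometric m hz).comp h2
    have h4 : Tendsto (fun a : ℝ => Real.log b / Real.log a) atTop (𝓝 0) :=
      tendsto_const_nhds.div_atTop Real.tendsto_log_atTop
    have h5 := h1.add ((h3.mul (h4.const_sub 1)).const_mul (S.mrcOutageCoeff (m + 1) γ))
    simpa [hypergeometricSum] using h5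
  refine hlim.congr' ?_
  filter_upwards [eventually_gt_atTop 1, eventually_gt_atTop b] with a ha hab
  have hla : 0 < Real.log a := Real.log_pos ha
  have ha0 : 0 < a := by linarith
  have hlb : Real.log a - Real.log b ≠ 0 := by
    have := Real.log_lt_log hb hab; linarith
  have hz : 1 - S.d₁ ^ S.τ * (b * S.dI ^ S.τ) / (S.dI ^ S.τ * (a * S.d₁ ^ S.τ)) = 1 - b / a := by
    field_simp
  have hd₂ : S.d₂ ^ (((m + 1 : ℕ) : ℝ) * S.τ) = (S.d₂ ^ S.τ) ^ (m + 1) := by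
    rw [mul_comm, Real.rpow_mul_natCast hS.d₂_pos.le]
  have hG : Real.Gamma (((m + 1 : ℕ) : ℝ) + 1) = ((m + 1).factorial : ℝ) :=
    Real.Gamma_nat_eq_factorial _
  have hG2 : Real.Gamma ((m + 1 : ℕ) : ℝ) = (m.factorial : ℝ) := by
    push_cast; exact Real.Gamma_nat_eq_factorial m
  rw [mrcOutageApprox, hz, sum_hypergeometric_reflect, hd₂, hG, hG2, ← hA, mrcOutageCoeff,
    Nat.add_sub_cancel, Real.log_div hb.ne' ha0.ne']
  generalize hypergeometricSum m (1 - b / a) = H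
  have e1 : (S.d₁ ^ S.τ * γ / (a * S.d₁ ^ S.τ)) ^ (m + 1) = γ ^ (m + 1) / a ^ (m + 1) := by
    rw [← div_pow]; congr 1; field_simp
  have e2 : H / -(Real.log b - Real.log a) * (1 - Real.log b / Real.log a) = H / Real.log a := by
    rw [neg_sub]; field_simp
  rw [e1, e2, div_pow, mul_pow, mul_pow]
  have : (m.factorial : ℝ) ≠ 0 := by positivity
  have : ((m + 1).factorial : ℝ) ≠ 0 := by positivity
  field_simp

end RelaySystem

/-! ### Diversity order and conclusion. -/

/-- A function equivalent to `C log ρ / ρ ^ N` has decay exponent `N`. -/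
lemma tendsto_neg_log_div_log {f : ℝ → ℝ} {C D : ℝ} {N : ℕ} (hC : 0 < C) (hD : 0 < D)
    (hf : Tendsto (fun a => f (a * D) * a ^ N / Real.log a) atTop (𝓝 C)) :
    Tendsto (fun ρ => -Real.log (f ρ) / Real.log ρ) atTop (𝓝 (N : ℝ)) := by
  have hll : Tendsto (fun a : ℝ => Real.log (Real.log a) / Real.log a) atTop (𝓝 0) := by
    have := Real.isLittleO_log_id_atTop.tendsto_div_nhds_zero.comp Real.tendsto_log_atTop
    simpa [Function.comp_def] using this
  have hla : Tendsto (fun a : ℝ => Real.log (f (a * D) * a ^ N / Real.log a) / Real.log a) atTop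
      (𝓝 0) :=
    ((Real.continuousAt_log hC.ne').tendsto.comp hf).div_atTop Real.tendsto_log_atTop
  have hlD : Tendsto (fun a : ℝ => Real.log D / Real.log a) atTop (𝓝 0) :=
    tendsto_const_nhds.div_atTop Real.tendsto_log_atTop
  have h1 : Tendsto (fun a : ℝ => -Real.log (f (a * D)) / Real.log (a * D)) atTop (𝓝 (N : ℝ)) := by
    have h2 := ((hla.add hll).const_sub (N : ℝ)).div (hlD.const_add 1) (by norm_num)
    simp only [add_zero, sub_zero, div_one] at h2
    refine h2.congr' ?_
    filter_upwards [hf.eventually_const_lt hC, eventually_gt_atTop 1] with a hpos ha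
    have ha0 : 0 < a := by linarith
    have hl : 0 < Real.log a := Real.log_pos ha
    have hf0 : 0 < f (a * D) := by
      rw [div_pos_iff_of_pos_right hl] at hpos
      exact pos_of_mul_pos_left hpos (by positivity)
    simp only [Pi.div_apply]
    rw [Real.log_div (by positivity) hl.ne', Real.log_mul hf0.ne' (by positivity), Real.log_pow,
      Real.log_mul ha0.ne' hD.ne']
    have e1 : (N : ℝ) - ((Real.log (f (a * D)) + N * Real.log a - Real.log (Real.log a)) /
        Real.log a + Real.log (Real.log a) / Real.log a) = -Real.log (f (a * D)) / Real.log a := by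
      field_simp; ring
    have e2 : 1 + Real.log D / Real.log a = (Real.log a + Real.log D) / Real.log a := by
      field_simp
    rw [e1, e2, div_div_div_cancel_right₀ hl.ne']
  have h3 := h1.comp (tendsto_id.atTop_div_const hD)
  refine h3.congr fun ρ => ?_
  simp [div_mul_cancel₀ _ hD.ne']

theorem theorem5 {Ω : Type*} [MeasurableSpace Ω] (μ : Measure Ω)
    (N : ℕ) (hN : 1 ≤ N) (h₁ hI h₂ : Ω → Fin N → ℂ) (hfading : IsRayleighFading μ h₁ hI h₂)
    (S : RelaySystem) (hS : S.Admissible)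
    (γth : ℝ) (hγ : 0 < γth) (ρI : ℝ) (hρI : 0 < ρI) :
    ((fun ρ₁ : ℝ => S.mrcOutage μ h₁ hI h₂ γth ρI ρ₁)
      ~[atTop] (fun ρ₁ : ℝ => S.mrcOutageApprox N γth ρI ρ₁)) ∧
    Tendsto (fun ρ₁ : ℝ => -Real.log (S.mrcOutage μ h₁ hI h₂ γth ρI ρ₁) / Real.log ρ₁)
      atTop (𝓝 (N : ℝ)) := by
  have hD₁ : 0 < S.d₁ ^ S.τ := Real.rpow_pos_of_pos hS.d₁_pos _
  have hDI : 0 < S.dI ^ S.τ := Real.rpow_pos_of_pos hS.dI_pos _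
  have hb : 0 < ρI / S.dI ^ S.τ := by positivity
  have hC : 0 < S.mrcOutageCoeff N γth := S.mrcOutageCoeff_pos hS hγ
  have hP := S.tendsto_mrcOutage_mul_pow_div_log hN hfading hS hb hγ
  have hQ := S.tendsto_mrcOutageApprox_mul_pow_div_log hN hS (γ := γth) hb
  rw [div_mul_cancel₀ _ hDI.ne'] at hP hQ
  refine ⟨?_, tendsto_neg_log_div_log hC hD₁ hP⟩
  have hdiv : Tendsto (fun ρ₁ : ℝ => ρ₁ / S.d₁ ^ S.τ) atTop atTop :=
    tendsto_id.atTop_div_const hD₁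
  have hP' := hP.comp hdiv
  have hQ' := hQ.comp hdiv
  simp only [Function.comp_def, div_mul_cancel₀ _ hD₁.ne'] at hP' hQ'
  -- The alternating signs hide nonvanishing of the approximation; it is read off from the nonzero
  -- limit.
  have hne : ∀ᶠ ρ₁ in atTop, S.mrcOutageApprox N γth ρI ρ₁ ≠ 0 := by
    filter_upwards [hQ'.eventually_ne hC.ne'] with ρ₁ h h0
    simp [h0] at h
  rw [isEquivalent_iff_tendsto_one hne]
  have h := hP'.div hQ' hC.ne'
  rw [div_self hC.ne'] at h
  refine h.congr' ?_
  filter_upwards [hdiv.eventually_gt_atTop 1] with ρ₁ hρ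
  have hl : Real.log (ρ₁ / S.d₁ ^ S.τ) ≠ 0 := (Real.log_pos hρ).ne'
  have hp : (ρ₁ / S.d₁ ^ S.τ) ^ N ≠ 0 := (by positivity : 0 < (ρ₁ / S.d₁ ^ S.τ) ^ N).ne'
  simp only [Pi.div_apply]
  rw [div_div_div_cancel_right₀ hl, mul_div_mul_right _ _ hp]
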